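/- For $M\in R^{n\times n}$ ($R=\mathbb{Q}$ or $\mathbb{R}$) and $\alpha\subseteq[n]$ let $M|_\alpha$ be the principal submatrix of $M$ with rows and columns in $\alpha$ (the empty determinant is $1$). A *non-positive minor* of $M$ is a set $\alpha\subseteq[n]$ with $\det(M|_\alpha)\le 0$; a *sign-reversing vector* of $M$ is a vector $x\in R^n$, $x\ne 0$, with $x_i(Mx)_i\le 0$ for all $i\in[n]$. **Theorem.** Non-positive minors can be converted to sign-reversing vectors in polynomial time. Precisely: 1. There are an algorithm (a program for the random access machine with bit cost, that is, every operation is charged according to the bit lengths of its operands) and a polynomial $p$ such that for every $n$, every $M\in\mathbb{Q}^{n\times n}$ and every $\alpha\subseteq[n]$ with $\det(M|_\alpha)\le 0$ the following holds. On input $(M,\alpha)$ the algorithm halts within time $p(n+B)$, where $B$ is the sum of the bit lengths of (the numerators and denominators of) the entries of $M$, and it outputs the numerators and denominators of the coordinates of a vector $x\in\mathbb{Q}^n$ that is a sign-reversing vector of $M$ and satisfies $x_i=0$ for all $i\notin\alpha$. If moreover $\det(M|_\alpha)=0$, then $x$ is a vector of the kernel of $M|_\alpha$, padded with zeros. 2.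 For every $n$, every $M\in\mathbb{R}^{n\times n}$ and every $\alpha\subseteq[n]$: if $\det(M|_\alpha)=0$, then $M|_\alpha$ has a non-zero kernel vector $y\in\mathbb{R}^\alpha$; if $\det(M|_\alpha)<0$, then $M|_\alpha$ has a negative real eigenvalue, with an eigenvector $y\in\mathbb{R}^\alpha$. Every non-zero kernel vector of $M|_\alpha$ and every real eigenvector of $M|_\alpha$ for a negative eigenvalue becomes, when padded with zeros, a sign-reversing vector of $M$. -/

import Mathlib

open scoped Matrix

/-! ### Principal minors and the two kinds of violation -/

section Violations

variable {R : Type*} [Field R] [LinearOrder R] {n : ℕ}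

/-- The principal submatrix of `M` with rows and columns in `α`. -/
def principal (M : Matrix (Fin n) (Fin n) R) (α : Finset (Fin n)) : Matrix α α R :=
  M.submatrix Subtype.val Subtype.val

/-- `α` is a *non-positive minor* of `M`. -/
def IsNonposMinor (M : Matrix (Fin n) (Fin n) R) (α : Finset (Fin n)) : Prop :=
  (principal M α).det ≤ 0

/-- `x` is a *sign-reversing vector* of `M`. -/
def IsSignReversing (M : Matrix (Fin n) (Fin n) R) (x : Fin n → R) : Prop :=
  x ≠ 0 ∧ ∀ i, x i * (M *ᵥ x) i ≤ 0

/-- The extension of a vector indexed by `α` by zeros outside `α`. -/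
def padZero (α : Finset (Fin n)) (y : α → R) : Fin n → R :=
  fun i => if h : i ∈ α then y ⟨i, h⟩ else 0

end Violations

/-! ### Random access machine with logarithmic (bit) cost

Programs manipulate integers that are stored in arrays indexed by integers. A program mentions
only finitely many arrays. Every operation is charged according to the bit lengths of the integers
that take part in it, including the addresses of the array cells that are read or written. -/

/-- Bit length of an integer: one bit for the sign and the binary digits of the absolute value. -/
def bitLen (z : ℤ) : ℕ := z.natAbs.size + 1

/-- `s a k` is the content of cell `k` of array number `a`. -/
abbrev RamMemory : Type := ℕ → ℤ → ℤ

/-- Integer expressions; `read a e` reads the cell of array `a` whose index is the value of `e`. -/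
inductive RamExpr : Type
  | const (z : ℤ)
  | read (a : ℕ) (e : RamExpr)
  | add (e f : RamExpr)
  | sub (e f : RamExpr)
  | mul (e f : RamExpr)
  | div (e f : RamExpr)

/-- Value of an expression; division is integer division with remainder (and `x / 0 = 0`). -/
def RamExpr.eval (s : RamMemory) : RamExpr → ℤ
  | .const z => z
  | .read a e => s a (e.eval s)
  | .add e f => e.eval s + f.eval s
  | .sub e f => e.eval s - f.eval s
  | .mul e f => e.eval s * f.eval s
  | .div e f => e.eval s / f.eval s

/-- Bit cost of evaluating an expression: linear in the bit lengths of the operands for reading,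
addition and subtraction, and their product for multiplication and division. -/
def RamExpr.cost (s : RamMemory) : RamExpr → ℕ
  | .const z => bitLen z
  | .read a e => e.cost s + bitLen (e.eval s) + bitLen (s a (e.eval s))
  | .add e f => e.cost s + f.cost s + (bitLen (e.eval s) + bitLen (f.eval s))
  | .sub e f => e.cost s + f.cost s + (bitLen (e.eval s) + bitLen (f.eval s))
  | .mul e f => e.cost s + f.cost s + bitLen (e.eval s) * bitLen (f.eval s)
  | .div e f => e.cost s + f.cost s + bitLen (e.eval s) * bitLen (f.eval s)

/-- Programs: do nothing, write the value of `e` into the cell of array `a` whose index is the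
value of `i`, sequential composition, branching on `0 < e`, and looping while `0 < e`. -/
inductive RamProg : Type
  | skip
  | write (a : ℕ) (i e : RamExpr)
  | seq (c d : RamProg)
  | branch (e : RamExpr) (c d : RamProg)
  | loop (e : RamExpr) (c : RamProg)

/-- `RamProg.Runs c s s' t`: started in memory `s`, the program `c` halts in memory `s'`, and the
run has total bit cost `t`. -/
inductive RamProg.Runs : RamProg → RamMemory → RamMemory → ℕ → Prop
  | skip (s : RamMemory) : Runs .skip s s 1
  | write (s : RamMemory) (a : ℕ) (i e : RamExpr) :
      Runs (.write a i e) s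
        (Function.update s a (Function.update (s a) (i.eval s) (e.eval s)))
        (i.cost s + e.cost s + bitLen (i.eval s) + bitLen (e.eval s) + 1)
  | seq {s s' s'' : RamMemory} {c d : RamProg} {t t' : ℕ} :
      Runs c s s' t → Runs d s' s'' t' → Runs (.seq c d) s s'' (t + t')
  | branch_pos {s s' : RamMemory} {e : RamExpr} {c d : RamProg} {t : ℕ} :
      0 < e.eval s → Runs c s s' t → Runs (.branch e c d) s s' (e.cost s + t + 1)
  | branch_neg {s s' : RamMemory} {e : RamExpr} {c d : RamProg} {t : ℕ} :
      ¬ 0 < e.eval s → Runs d s s' t → Runs (.branch e c d) s s' (e.cost s + t + 1)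
  | loop_stop {s : RamMemory} {e : RamExpr} {c : RamProg} :
      ¬ 0 < e.eval s → Runs (.loop e c) s s (e.cost s + 1)
  | loop_step {s s' s'' : RamMemory} {e : RamExpr} {c : RamProg} {t t' : ℕ} :
      0 < e.eval s → Runs c s s' t → Runs (.loop e c) s' s'' t' →
        Runs (.loop e c) s s'' (e.cost s + t + t' + 1)

/-! ### Input, input size and output -/

section InputOutput

variable {n : ℕ}

/-- The array that stores an `n × n` table row by row: cell `i * n + j` holds entry `(i, j)`, and
all other cells hold zero. -/
def rowMajor (f : Fin n → Fin n → ℤ) : ℤ → ℤ :=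
  fun k => ∑ i : Fin n, ∑ j : Fin n, if k = ((i : ℕ) : ℤ) * n + ((j : ℕ) : ℤ) then f i j else 0

theorem rowMajor_apply (f : Fin n → Fin n → ℤ) (i j : Fin n) :
    rowMajor f (((i : ℕ) : ℤ) * n + ((j : ℕ) : ℤ)) = f i j := by
  have key : ∀ i' j' : Fin n, ((i : ℕ) : ℤ) * n + ((j : ℕ) : ℤ) =
      ((i' : ℕ) : ℤ) * n + ((j' : ℕ) : ℤ) ↔ (i = i' ∧ j = j') := by
    intro i' j'
    constructor
    · intro h
      have h' : n * (i : ℕ) + j = n * (i' : ℕ) + j' := by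
        have : (i : ℕ) * n + j = (i' : ℕ) * n + j' := by exact_mod_cast h
        simpa [Nat.mul_comm] using this
      have h1 := congrArg (· / n) h'
      have h2 := congrArg (· % n) h'
      have hn : 0 < n := i.pos
      simp only [Nat.mul_add_div hn, Nat.div_eq_of_lt j.isLt, Nat.div_eq_of_lt j'.isLt,
        Nat.mul_add_mod, Nat.mod_eq_of_lt j.isLt, Nat.mod_eq_of_lt j'.isLt] at h1 h2
      exact ⟨Fin.ext (by simpa using h1), Fin.ext h2⟩
    · rintro ⟨rfl, rfl⟩
      rfl
  simp only [rowMajor, key]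
  rw [Finset.sum_eq_single i (fun b _ hb => by simp [Ne.symm hb]) (by simp)]
  simp

/-- Initial memory for a rational matrix `M` and a subset `α`: cell `0` of array `0` holds `n`,
array `1` holds the indicator of `α`, arrays `2` and `3` hold the numerators and the denominators
of the entries of `M` in lowest terms; everything else is zero. -/
def inputMemory (M : Matrix (Fin n) (Fin n) ℚ) (α : Finset (Fin n)) : RamMemory
  | 0 => fun k => if k = 0 then (n : ℤ) else 0
  | 1 => fun k => if ∃ i ∈ α, ((i : ℕ) : ℤ) = k then 1 else 0
  | 2 => rowMajor fun i j => (M i j).num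
  | 3 => rowMajor fun i j => ((M i j).den : ℤ)
  | _ => 0

/-- The sum of the bit lengths of the entries (numerators and denominators) of `M`. -/
def bitSize (M : Matrix (Fin n) (Fin n) ℚ) : ℕ :=
  ∑ i, ∑ j, (bitLen (M i j).num + bitLen (M i j).den)

/-- On input `(M, α)` the program `c` halts with total bit cost at most `T`, and its output is the
vector `x`: array `4` holds numerators and array `5` non-zero denominators of its coordinates. -/
def OutputsWithin (c : RamProg) (M : Matrix (Fin n) (Fin n) ℚ) (α : Finset (Fin n)) (T : ℕ)
    (x : Fin n → ℚ) : Prop :=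
  ∃ (s : RamMemory) (t : ℕ), c.Runs (inputMemory M α) s t ∧ t ≤ T ∧
    ∀ i : Fin n, s 5 (i : ℕ) ≠ 0 ∧ x i = (s 4 (i : ℕ) : ℚ) / (s 5 (i : ℕ) : ℚ)

end InputOutput

/-! ### Cost bounds and weakest preconditions for programs -/

/-! Part 1 needs no eigenvectors. Let `L > 0` be the product of all denominators, `A = L • M`, and
let `X_k = rowMask A α k`. Then `det X_0 = 1`, while `det X_n = L ^ |α| * det (M|_α) ≤ 0`
(`det_rowMask`), so there is a first `j` with `det X_j > 0 ≥ det X_{j+1}`. Let `x` be column `j` of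
the adjugate of `X_{j+1}`. Then `X_{j+1} x = det X_{j+1} • e_j`, and `x_j` is the cofactor `det
X_j`. Hence `x_j (A x)_j = det X_j * det X_{j+1} ≤ 0`, and for every other `i` either `(A x)_i = 0`
or `x_i = 0` (`isConversion_of_adjugate`). If `det X_n = 0`, a kernel vector of `X_n` is used
instead; its unit rows force the support into `α`.

Determinants, adjugates and kernel vectors all come from the Faddeev–LeVerrier recursion `P_0 = 1`,
`P_{r+1} = c_r • 1 - X P_r`, `c_r = tr (X P_r) / (r + 1)`. It divides only by `r + 1`, exactly, and
needs no pivoting. The `P_r` are the coefficient matrices of the adjugate of the polynomial matrix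
`X + N` (`fadLev_eq`), so `P_{n-1}` is the adjugate, `c_{n-1}` the determinant and `P_n = 0`. For a
singular matrix the last non-zero `P_r` satisfies `X P_r = 0` (`mul_fadLevMat_eq_zero`), so its
non-zero columns are kernel vectors. The entries of `P_r` are at most `G ^ r`, with `G` of
polynomial bit length (`natAbs_fadLevMat_le`).

For the running time, one number `N` bounds the digits of all cells and the rounds of all loops. The
cost is then a polynomial in `N` read off the program text, and `N` is a polynomial in the input
size.

For part 2, a negative determinant yields a negative eigenvalue by the intermediate value theorem
applied to `t ↦ det (t + A)`. -/

theorem bitLen_add_le (x y : ℤ) : bitLen (x + y) ≤ bitLen x + bitLen y := by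
  have hx : x.natAbs < 2 ^ x.natAbs.size := Nat.lt_size_self _
  have hy : y.natAbs < 2 ^ y.natAbs.size := Nat.lt_size_self _
  have h1 : 2 ^ x.natAbs.size ≤ 2 ^ (x.natAbs.size + y.natAbs.size) :=
    Nat.pow_le_pow_right (by norm_num) (by omega)
  have h2 : 2 ^ y.natAbs.size ≤ 2 ^ (x.natAbs.size + y.natAbs.size) :=
    Nat.pow_le_pow_right (by norm_num) (by omega)
  have h : (x + y).natAbs.size ≤ x.natAbs.size + y.natAbs.size + 1 := by
    rw [Nat.size_le, pow_succ]
    have := Int.natAbs_add_le x y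
    omega
  simp only [bitLen]
  omega

theorem bitLen_neg (x : ℤ) : bitLen (-x) = bitLen x := by simp [bitLen]

theorem bitLen_sub_le (x y : ℤ) : bitLen (x - y) ≤ bitLen x + bitLen y := by
  rw [sub_eq_add_neg, ← bitLen_neg y]
  exact bitLen_add_le _ _

theorem bitLen_mul_le (x y : ℤ) : bitLen (x * y) ≤ bitLen x + bitLen y := by
  have hx : x.natAbs < 2 ^ x.natAbs.size := Nat.lt_size_self _
  have hy : y.natAbs < 2 ^ y.natAbs.size := Nat.lt_size_self _
  have h : (x * y).natAbs.size ≤ x.natAbs.size + y.natAbs.size := by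
    rw [Nat.size_le, pow_add, Int.natAbs_mul]
    exact Nat.mul_lt_mul'' hx hy
  simp only [bitLen]
  omega

theorem bitLen_ediv_le (x y : ℤ) : bitLen (x / y) ≤ bitLen x := by
  have := Nat.size_le_size (Int.natAbs_ediv_le_natAbs x y)
  simp only [bitLen]
  omega

/-- All cells hold integers with at most `N` binary digits. -/
def RamMemory.Bdd (N : ℕ) (s : RamMemory) : Prop := ∀ a k, (s a k).natAbs < 2 ^ N

theorem RamMemory.Bdd.bitLen_le {N : ℕ} {s : RamMemory} (h : s.Bdd N) (a : ℕ) (k : ℤ) :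
    bitLen (s a k) ≤ N + 1 :=
  Nat.succ_le_succ (Nat.size_le.2 (h a k))

/-- Bound for the bit length of the value of an expression, in terms of the memory width. -/
noncomputable def RamExpr.widthPoly : RamExpr → Polynomial ℕ
  | .const z => Polynomial.C (bitLen z)
  | .read _ _ => Polynomial.X + 1
  | .add e f => e.widthPoly + f.widthPoly
  | .sub e f => e.widthPoly + f.widthPoly
  | .mul e f => e.widthPoly + f.widthPoly
  | .div e f => e.widthPoly + f.widthPoly

/-- Bound for the cost of an expression, in terms of the memory width. -/
noncomputable def RamExpr.costPoly : RamExpr → Polynomial ℕ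
  | .const z => Polynomial.C (bitLen z)
  | .read _ e => e.costPoly + e.widthPoly + (Polynomial.X + 1)
  | .add e f => e.costPoly + f.costPoly + (e.widthPoly + f.widthPoly)
  | .sub e f => e.costPoly + f.costPoly + (e.widthPoly + f.widthPoly)
  | .mul e f => e.costPoly + f.costPoly + e.widthPoly * f.widthPoly
  | .div e f => e.costPoly + f.costPoly + e.widthPoly * f.widthPoly

theorem RamExpr.bitLen_eval_le {N : ℕ} {s : RamMemory} (h : s.Bdd N) (e : RamExpr) :
    bitLen (e.eval s) ≤ e.widthPoly.eval N := by
  induction e with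
  | const z => simp [RamExpr.eval, RamExpr.widthPoly]
  | read a e ih => simpa [RamExpr.eval, RamExpr.widthPoly] using h.bitLen_le a _
  | add e f he hf =>
    simpa [RamExpr.eval, RamExpr.widthPoly] using (bitLen_add_le _ _).trans (add_le_add he hf)
  | sub e f he hf =>
    simpa [RamExpr.eval, RamExpr.widthPoly] using (bitLen_sub_le _ _).trans (add_le_add he hf)
  | mul e f he hf =>
    simpa [RamExpr.eval, RamExpr.widthPoly] using (bitLen_mul_le _ _).trans (add_le_add he hf)
  | div e f he hf =>
    simpa [RamExpr.eval, RamExpr.widthPoly] using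
      (bitLen_ediv_le _ _).trans (he.trans (Nat.le_add_right _ _))

theorem RamExpr.cost_le {N : ℕ} {s : RamMemory} (h : s.Bdd N) (e : RamExpr) :
    e.cost s ≤ e.costPoly.eval N := by
  induction e with
  | const z => simp [RamExpr.cost, RamExpr.costPoly]
  | read a e ih =>
    have := e.bitLen_eval_le h
    have := h.bitLen_le a (e.eval s)
    simp only [RamExpr.cost, RamExpr.costPoly, Polynomial.eval_add, Polynomial.eval_X,
      Polynomial.eval_one]
    omega
  | add e f he hf =>
    have := e.bitLen_eval_le h
    have := f.bitLen_eval_le h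
    simp only [RamExpr.cost, RamExpr.costPoly, Polynomial.eval_add]
    omega
  | sub e f he hf =>
    have := e.bitLen_eval_le h
    have := f.bitLen_eval_le h
    simp only [RamExpr.cost, RamExpr.costPoly, Polynomial.eval_add]
    omega
  | mul e f he hf =>
    simp only [RamExpr.cost, RamExpr.costPoly, Polynomial.eval_add, Polynomial.eval_mul]
    exact add_le_add (add_le_add he hf) (mul_le_mul' (e.bitLen_eval_le h) (f.bitLen_eval_le h))
  | div e f he hf =>
    simp only [RamExpr.cost, RamExpr.costPoly, Polynomial.eval_add, Polynomial.eval_mul]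
    exact add_le_add (add_le_add he hf) (mul_le_mul' (e.bitLen_eval_le h) (f.bitLen_eval_le h))

/-- Bound for the running time of a program, in terms of a number that bounds both the memory
width and the number of iterations of every loop. -/
noncomputable def RamProg.timePoly : RamProg → Polynomial ℕ
  | .skip => 1
  | .write _ i e => i.costPoly + e.costPoly + i.widthPoly + e.widthPoly + 1
  | .seq c d => c.timePoly + d.timePoly
  | .branch e c d => e.costPoly + (c.timePoly + d.timePoly) + 1
  | .loop e c => (Polynomial.X + 1) * (e.costPoly + c.timePoly + 1)

/-- The arrays that a program may modify. -/
def RamProg.writes : RamProg → List ℕ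
  | .skip => []
  | .write a _ _ => [a]
  | .seq c d => c.writes ++ d.writes
  | .branch _ c d => c.writes ++ d.writes
  | .loop _ c => c.writes

/-- The frame rule: specifications need to speak only about arrays that a program writes. `WP.mono`
passes this information on to the postcondition. -/
theorem RamProg.Runs.frame {c : RamProg} {s s' : RamMemory} {t : ℕ} (h : c.Runs s s' t) :
    ∀ a ∉ c.writes, s' a = s a := by
  induction h with
  | skip s => exact fun _ _ => rfl
  | write s a i e =>
    intro b hb
    simp only [RamProg.writes, List.mem_singleton] at hb
    simp [hb]
  | seq _ _ ih ih' =>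
    intro b hb
    simp only [RamProg.writes, List.mem_append, not_or] at hb
    rw [ih' b hb.2, ih b hb.1]
  | branch_pos _ _ ih =>
    intro b hb
    simp only [RamProg.writes, List.mem_append, not_or] at hb
    exact ih b hb.1
  | branch_neg _ _ ih =>
    intro b hb
    simp only [RamProg.writes, List.mem_append, not_or] at hb
    exact ih b hb.2
  | loop_stop _ => exact fun _ _ => rfl
  | loop_step _ _ _ ih ih' =>
    intro b hb
    rw [ih' b hb, ih b hb]

/-- Weakest precondition: from the memory `s`, if it has width at most `N`, the program `c` halts
in the time given by `c.timePoly`, in a memory of width at most `N` that satisfies `Q`. -/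
def RamProg.WP (N : ℕ) (c : RamProg) (s : RamMemory) (Q : RamMemory → Prop) : Prop :=
  s.Bdd N → ∃ s' t, c.Runs s s' t ∧ t ≤ c.timePoly.eval N ∧ s'.Bdd N ∧ Q s'

namespace RamProg.WP

variable {N : ℕ} {c d : RamProg} {s : RamMemory} {Q R : RamMemory → Prop}

theorem mono (h : c.WP N s Q) (hQ : ∀ s', (∀ a ∉ c.writes, s' a = s a) → Q s' → R s') :
    c.WP N s R := by
  intro hs
  obtain ⟨s', t, hr, ht, hb, hq⟩ := h hs
  exact ⟨s', t, hr, ht, hb, hQ s' hr.frame hq⟩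

theorem of_bdd (h : s.Bdd N → c.WP N s Q) : c.WP N s Q := fun hs => h hs hs

theorem skip (h : Q s) : RamProg.skip.WP N s Q :=
  fun hs => ⟨s, 1, .skip s, by simp [RamProg.timePoly], hs, h⟩

/-- Memory grows only by writing, so this is where size bounds have to be proved. The index needs
none: it is an expression evaluated in a bounded memory, and `widthPoly` bounds its length. -/
theorem write {a : ℕ} {i e : RamExpr} (hv : (e.eval s).natAbs < 2 ^ N)
    (h : Q (Function.update s a (Function.update (s a) (i.eval s) (e.eval s)))) :
    (RamProg.write a i e).WP N s Q := by
  intro hs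
  refine ⟨_, _, .write s a i e, ?_, ?_, h⟩
  · have := i.cost_le hs
    have := e.cost_le hs
    have := i.bitLen_eval_le hs
    have := e.bitLen_eval_le hs
    simp only [RamProg.timePoly, Polynomial.eval_add, Polynomial.eval_one]
    omega
  · intro b k
    by_cases hb : b = a
    · subst hb
      by_cases hk : k = i.eval s
      · simpa [hk] using hv
      · simpa [hk] using hs b k
    · simpa [hb] using hs b k

theorem seq (h : c.WP N s fun s' => d.WP N s' Q) : (RamProg.seq c d).WP N s Q := by
  intro hs
  obtain ⟨s', t, hr, ht, hb, hq⟩ := h hs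
  obtain ⟨s'', t', hr', ht', hb', hq'⟩ := hq hb
  exact ⟨s'', t + t', .seq hr hr', by simpa [RamProg.timePoly] using add_le_add ht ht', hb', hq'⟩

theorem branch {e : RamExpr} (hpos : 0 < e.eval s → c.WP N s Q)
    (hneg : ¬ 0 < e.eval s → d.WP N s Q) : (RamProg.branch e c d).WP N s Q := by
  intro hs
  have he := e.cost_le hs
  by_cases h : 0 < e.eval s
  · obtain ⟨s', t, hr, ht, hb, hq⟩ := hpos h hs
    refine ⟨s', _, .branch_pos h hr, ?_, hb, hq⟩
    simp only [RamProg.timePoly, Polynomial.eval_add, Polynomial.eval_one]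
    omega
  · obtain ⟨s', t, hr, ht, hb, hq⟩ := hneg h hs
    refine ⟨s', _, .branch_neg h hr, ?_, hb, hq⟩
    simp only [RamProg.timePoly, Polynomial.eval_add, Polynomial.eval_one]
    omega

/-- The number `k` of rounds is fixed in advance and bounded by the same `N` as the memory width.
The extra round in `timePoly` pays for the test that ends the loop. -/
theorem loop {e : RamExpr} (I : ℕ → RamMemory → Prop) (k : ℕ) (hk : k ≤ N) (h0 : I 0 s)
    (hstep : ∀ i < k, ∀ s', I i s' → 0 < e.eval s' ∧ c.WP N s' (I (i + 1)))
    (hlast : ∀ s', I k s' → ¬ 0 < e.eval s' ∧ Q s') : (RamProg.loop e c).WP N s Q := by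
  intro hs
  have key : ∀ j, ∀ i, i + j = k → ∀ s', I i s' → s'.Bdd N →
      ∃ s'' t, (RamProg.loop e c).Runs s' s'' t ∧
        t ≤ (j + 1) * (e.costPoly.eval N + c.timePoly.eval N + 1) ∧ s''.Bdd N ∧ Q s'' := by
    intro j
    induction j with
    | zero =>
      intro i hi s' hI hb
      obtain rfl : i = k := hi
      have := e.cost_le hb
      have hrun : (RamProg.loop e c).Runs s' s' (e.cost s' + 1) :=
        RamProg.Runs.loop_stop (hlast s' hI).1
      exact ⟨s', _, hrun, by omega, hb, (hlast s' hI).2⟩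
    | succ j ih =>
      intro i hi s' hI hb
      obtain ⟨hpos, hw⟩ := hstep i (by omega) s' hI
      obtain ⟨s1, t1, hr1, ht1, hb1, hI1⟩ := hw hb
      obtain ⟨s2, t2, hr2, ht2, hb2, hq⟩ := ih (i + 1) (by omega) s1 hI1 hb1
      have := e.cost_le hb
      refine ⟨s2, _, .loop_step hpos hr1 hr2, ?_, hb2, hq⟩
      rw [add_mul _ 1]
      omega
  obtain ⟨s', t, hr, ht, hb, hq⟩ := key k 0 (by omega) s h0 hs
  refine ⟨s', t, hr, ht.trans ?_, hb, hq⟩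
  simp only [RamProg.timePoly, Polynomial.eval_add, Polynomial.eval_one, Polynomial.eval_mul,
    Polynomial.eval_X]
  gcongr

end RamProg.WP

/-- The scalar variable stored in cell `0` of array `a`. -/
def RamExpr.var (a : ℕ) : RamExpr := .read a (.const 0)

/-- Assignment to the scalar variable stored in cell `0` of array `a`. -/
def RamProg.assign (a : ℕ) (e : RamExpr) : RamProg := .write a (.const 0) e

/-- Counting loop: the variable `v` runs from `0` below the value of `b`. -/
def RamProg.forLoop (v : ℕ) (b : RamExpr) (c : RamProg) : RamProg :=
  .seq (.assign v (.const 0))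
    (.loop (.sub b (.var v)) (.seq c (.assign v (.add (.var v) (.const 1)))))

@[simp] theorem RamExpr.eval_const (s : RamMemory) (z : ℤ) : (RamExpr.const z).eval s = z := rfl
@[simp] theorem RamExpr.eval_read (s : RamMemory) (a : ℕ) (e : RamExpr) :
    (RamExpr.read a e).eval s = s a (e.eval s) := rfl
@[simp] theorem RamExpr.eval_var (s : RamMemory) (a : ℕ) : (RamExpr.var a).eval s = s a 0 := rfl
@[simp] theorem RamExpr.eval_add (s : RamMemory) (e f : RamExpr) :
    (RamExpr.add e f).eval s = e.eval s + f.eval s := rfl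
@[simp] theorem RamExpr.eval_sub (s : RamMemory) (e f : RamExpr) :
    (RamExpr.sub e f).eval s = e.eval s - f.eval s := rfl
@[simp] theorem RamExpr.eval_mul (s : RamMemory) (e f : RamExpr) :
    (RamExpr.mul e f).eval s = e.eval s * f.eval s := rfl
@[simp] theorem RamExpr.eval_div (s : RamMemory) (e f : RamExpr) :
    (RamExpr.div e f).eval s = e.eval s / f.eval s := rfl

theorem RamProg.WP.assign {N : ℕ} {s : RamMemory} {Q : RamMemory → Prop} {a : ℕ} {e : RamExpr}
    (hv : (e.eval s).natAbs < 2 ^ N)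
    (h : ∀ s' : RamMemory, (∀ b, b ≠ a → s' b = s b) → s' a 0 = e.eval s → Q s') :
    (RamProg.assign a e).WP N s Q :=
  .write hv (h _ (fun b hb => by simp [hb]) (by simp))

/-- The invariant must ignore the counter (`hI`), because the counter changes between rounds; its
value is supplied to `hstep` separately. The bound is evaluated again before every round, hence `hb`
for all memories that agree with `s` off the loop's own arrays. -/
theorem RamProg.WP.forLoop {N : ℕ} {s : RamMemory} {Q : RamMemory → Prop} {v : ℕ} {b : RamExpr}
    {c : RamProg} (I : ℕ → RamMemory → Prop) (k : ℕ) (hk : k ≤ N) (hv : v ∉ c.writes)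
    (hI : ∀ i s' s'', (∀ a, a ≠ v → s'' a = s' a) → I i s' → I i s'')
    (hb : ∀ s' : RamMemory, (∀ a, a ≠ v → a ∉ c.writes → s' a = s a) → b.eval s' = k)
    (h0 : I 0 s)
    (hstep : ∀ i < k, ∀ s' : RamMemory, (∀ a, a ≠ v → a ∉ c.writes → s' a = s a) →
      s' v 0 = i → I i s' → c.WP N s' (I (i + 1)))
    (hQ : ∀ s' : RamMemory, (∀ a, a ≠ v → a ∉ c.writes → s' a = s a) → I k s' → Q s') :
    (RamProg.forLoop v b c).WP N s Q := by
  refine .seq (.assign (by simp) fun s1 hs1 hs1v => ?_)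
  refine .loop (fun i s' => (∀ a, a ≠ v → a ∉ c.writes → s' a = s a) ∧ s' v 0 = i ∧ I i s')
    k hk ⟨fun a ha _ => hs1 a ha, by simpa using hs1v, hI _ _ _ hs1 h0⟩ ?_ ?_
  · rintro i hi s' ⟨hfr, hvi, hIi⟩
    refine ⟨?_, .seq ((hstep i hi s' hfr hvi hIi).mono fun s2 hs2 hI2 => ?_)⟩
    · simp only [RamExpr.eval_sub, RamExpr.eval_var, hb s' hfr, hvi]
      omega
    · have hv2 : s2 v 0 = i := by rw [hs2 v hv, hvi]
      refine .assign ?_ fun s3 hs3 hs3v => ⟨fun a ha ha' => ?_, ?_, hI _ _ _ hs3 hI2⟩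
      · have : N < 2 ^ N := Nat.lt_two_pow_self
        simp only [RamExpr.eval_add, RamExpr.eval_var, RamExpr.eval_const, hv2]
        omega
      · rw [hs3 a ha, hs2 a ha', hfr a ha ha']
      · simp [hs3v, hv2]
  · rintro s' ⟨hfr, hvk, hIk⟩
    refine ⟨?_, hQ s' hfr hIk⟩
    simp only [RamExpr.eval_sub, RamExpr.eval_var, hb s' hfr, hvk]
    omega

/-! ### The Faddeev–LeVerrier recursion over the integers -/

section FaddeevLeVerrier

open Polynomial

variable {n : ℕ}

/-- Jacobi's formula. Differentiating a Leibniz product at column `i` replaces that column of the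
characteristic matrix by a unit vector, which leaves the cofactor at `(i, i)`. -/
theorem Matrix.derivative_charpoly_eq_trace_adjugate {R : Type*} [CommRing R]
    (M : Matrix (Fin n) (Fin n) R) :
    derivative M.charpoly = (M.charmatrix.adjugate).trace := by
  have hd : ∀ i j, derivative (M.charmatrix i j) = (Pi.single j 1 : Fin n → R[X]) i := by
    intro i j
    rcases eq_or_ne i j with rfl | h
    · simp [Matrix.charmatrix_apply_eq]
    · simp [h]
  have hadj : ∀ i, M.charmatrix.adjugate i i =
      (M.charmatrix.updateCol i (Pi.single i 1)).det := by
    intro i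
    rw [← Matrix.transpose_apply M.charmatrix.adjugate, Matrix.adjugate_transpose,
      Matrix.adjugate_apply, Matrix.updateRow_transpose, Matrix.det_transpose]
  simp only [Matrix.trace, Matrix.diag_apply, hadj, Matrix.charpoly]
  simp only [Matrix.det_apply, map_sum, Polynomial.derivative_smul]
  rw [Finset.sum_comm]
  refine Finset.sum_congr rfl fun σ _ => ?_
  rw [Polynomial.derivative_prod_finset, Finset.smul_sum]
  refine Finset.sum_congr rfl fun i _ => ?_
  congr 1
  rw [hd, ← Finset.mul_prod_erase _ _ (Finset.mem_univ i), mul_comm]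
  congr 1
  · simp
  · refine Finset.prod_congr rfl fun j hj => ?_
    rw [Matrix.updateCol_ne (Finset.ne_of_mem_erase hj)]

/-- The matrices of the Faddeev–LeVerrier recursion. -/
def fadLevMat (N : Matrix (Fin n) (Fin n) ℤ) : ℕ → Matrix (Fin n) (Fin n) ℤ
  | 0 => 1
  | r + 1 => ((N * fadLevMat N r).trace / (r + 1)) • 1 - N * fadLevMat N r

/-- The coefficients of the Faddeev–LeVerrier recursion. -/
def fadLevCoeff (N : Matrix (Fin n) (Fin n) ℤ) (r : ℕ) : ℤ :=
  (N * fadLevMat N r).trace / (r + 1)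

theorem fadLevMat_succ (N : Matrix (Fin n) (Fin n) ℤ) (r : ℕ) :
    fadLevMat N (r + 1) = fadLevCoeff N r • 1 - N * fadLevMat N r := rfl

/-- The coefficient matrices of the adjugate of `X + N`. -/
noncomputable def adjCoeff (N : Matrix (Fin n) (Fin n) ℤ) (j : ℕ) : Matrix (Fin n) (Fin n) ℤ :=
  ((-N).charmatrix.adjugate).map fun p => p.coeff j

theorem charmatrix_neg_mul_apply (N : Matrix (Fin n) (Fin n) ℤ) (A : Matrix (Fin n) (Fin n) ℤ[X])
    (i k : Fin n) : ((-N).charmatrix * A) i k = X * A i k + ∑ m, C (N i m) * A m k := by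
  simp only [Matrix.mul_apply, Matrix.charmatrix_apply, Matrix.neg_apply, C_neg, sub_neg_eq_add,
    add_mul, Finset.sum_add_distrib]
  simp [Matrix.diagonal_apply]

theorem adjCoeff_zero_mul (N : Matrix (Fin n) (Fin n) ℤ) :
    N * adjCoeff N 0 = (-N).charpoly.coeff 0 • 1 := by
  ext i k
  have h := congrArg (fun A : Matrix (Fin n) (Fin n) ℤ[X] => (A i k).coeff 0)
    (Matrix.mul_adjugate (-N).charmatrix)
  simp only [charmatrix_neg_mul_apply, Matrix.smul_apply, coeff_add, finsetSum_coeff,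
    mul_coeff_zero, coeff_X_zero, zero_mul, zero_add, smul_eq_mul] at h
  simp only [Matrix.mul_apply, adjCoeff, Matrix.map_apply, Matrix.smul_apply, smul_eq_mul,
    Matrix.charpoly, Matrix.one_apply]
  simp only [coeff_C_zero] at h
  rw [h, Matrix.one_apply]
  split_ifs <;> simp

/-- Coefficient of `X ^ (j + 1)` in `(X + N) * adj (X + N) = det (X + N)`. Using the characteristic
matrix of `-N` avoids all alternating signs. -/
theorem adjCoeff_add_mul (N : Matrix (Fin n) (Fin n) ℤ) (j : ℕ) :
    adjCoeff N j + N * adjCoeff N (j + 1) = (-N).charpoly.coeff (j + 1) • 1 := by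
  ext i k
  have h := congrArg (fun A : Matrix (Fin n) (Fin n) ℤ[X] => (A i k).coeff (j + 1))
    (Matrix.mul_adjugate (-N).charmatrix)
  simp only [charmatrix_neg_mul_apply, Matrix.smul_apply, coeff_add, finsetSum_coeff, coeff_C_mul,
    coeff_X_mul, smul_eq_mul] at h
  simp only [Matrix.mul_apply, Matrix.add_apply, adjCoeff, Matrix.map_apply, Matrix.smul_apply,
    smul_eq_mul, Matrix.charpoly, h, Matrix.one_apply]
  split_ifs <;> simp

theorem trace_adjCoeff (N : Matrix (Fin n) (Fin n) ℤ) (j : ℕ) :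
    (adjCoeff N j).trace = (j + 1) * (-N).charpoly.coeff (j + 1) := by
  have h := congrArg (fun p => p.coeff j) (Matrix.derivative_charpoly_eq_trace_adjugate (-N))
  simp only [coeff_derivative, Matrix.trace, finsetSum_coeff, Matrix.diag_apply] at h
  simp only [Matrix.trace, adjCoeff, Matrix.diag_apply, Matrix.map_apply, ← h]
  ring

/-- The coefficients vanish for large `j`. From there one descends to `n`: for `j ≥ n` the
characteristic polynomial has no coefficient `j + 1`, so `adjCoeff N j = -N * adjCoeff N (j + 1)`.
-/
theorem adjCoeff_eq_zero (N : Matrix (Fin n) (Fin n) ℤ) {j : ℕ} (hj : n ≤ j) :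
    adjCoeff N j = 0 := by
  have hbig : ∃ m, ∀ j, m ≤ j → adjCoeff N j = 0 := by
    refine ⟨(∑ i, ∑ k, ((-N).charmatrix.adjugate i k).natDegree) + 1, fun j hj => ?_⟩
    ext i k
    refine coeff_eq_zero_of_natDegree_lt (lt_of_lt_of_le (Nat.lt_succ_of_le ?_) hj)
    exact (Finset.single_le_sum (f := fun k => ((-N).charmatrix.adjugate i k).natDegree)
      (fun _ _ => Nat.zero_le _) (Finset.mem_univ k)).trans
      (Finset.single_le_sum (f := fun i => ∑ k, ((-N).charmatrix.adjugate i k).natDegree)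
      (fun _ _ => Nat.zero_le _) (Finset.mem_univ i))
  obtain ⟨m, hm⟩ := hbig
  have key : ∀ d j, n ≤ j → m ≤ j + d → adjCoeff N j = 0 := by
    intro d
    induction d with
    | zero => exact fun j _ h => hm j h
    | succ d ih =>
      intro j hj h
      have h1 := adjCoeff_add_mul N j
      rw [ih (j + 1) (by omega) (by omega), coeff_eq_zero_of_natDegree_lt] at h1
      · simpa using h1
      · rw [Matrix.charpoly_natDegree_eq_dim, Fintype.card_fin]
        omega
  exact key m j hj (by omega)

/-- Both sequences obey the same recursion, starting from the leading coefficient `1`. Taking traces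
in `adjCoeff_add_mul` and inserting Jacobi's formula gives the third claim, which says that the
division in `fadLevCoeff` is exact. -/
theorem fadLev_eq (N : Matrix (Fin n) (Fin n) ℤ) (r : ℕ) (hr : r < n) :
    fadLevMat N r = adjCoeff N (n - 1 - r) ∧
      fadLevCoeff N r = (-N).charpoly.coeff (n - 1 - r) ∧
      (N * fadLevMat N r).trace = (r + 1) * fadLevCoeff N r := by
  have hcoeff : ∀ r, r < n → fadLevMat N r = adjCoeff N (n - 1 - r) →
      fadLevCoeff N r = (-N).charpoly.coeff (n - 1 - r) ∧
      (N * fadLevMat N r).trace = (r + 1) * fadLevCoeff N r := by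
    intro r hr h
    have htr : (N * fadLevMat N r).trace = (r + 1) * (-N).charpoly.coeff (n - 1 - r) := by
      rw [h]
      -- The constant coefficient has no predecessor, so index zero uses `adjCoeff_zero_mul`.
      rcases hj : n - 1 - r with _ | j
      · obtain rfl : n = r + 1 := by omega
        rw [adjCoeff_zero_mul, Matrix.trace_smul, Matrix.trace_one]
        simp [mul_comm]
      · have h1 := congrArg Matrix.trace (adjCoeff_add_mul N j)
        rw [Matrix.trace_add, Matrix.trace_smul, Matrix.trace_one, trace_adjCoeff,
          Fintype.card_fin] at h1
        have h2 : (n : ℤ) = r + 1 + (j + 1) := by omega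
        rw [h2, smul_eq_mul] at h1
        linear_combination h1
    have hc : fadLevCoeff N r = (-N).charpoly.coeff (n - 1 - r) := by
      rw [fadLevCoeff, htr]
      exact Int.mul_ediv_cancel_left _ (by omega)
    exact ⟨hc, by rw [htr, hc]⟩
  have hmat : fadLevMat N r = adjCoeff N (n - 1 - r) := by
    induction r with
    | zero =>
      have h1 := adjCoeff_add_mul N (n - 1)
      have hn : n - 1 + 1 = n := by omega
      have hlead : (-N).charpoly.coeff n = 1 := by
        have := (-N).charpoly_monic.coeff_natDegree
        rwa [Matrix.charpoly_natDegree_eq_dim, Fintype.card_fin] at this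
      rw [hn, adjCoeff_eq_zero N le_rfl, hlead] at h1
      simpa [fadLevMat] using h1.symm
    | succ r ih =>
      have h0 := ih (by omega)
      have h1 := adjCoeff_add_mul N (n - 1 - (r + 1))
      have hn : n - 1 - (r + 1) + 1 = n - 1 - r := by omega
      rw [hn, ← h0, ← (hcoeff r (by omega) h0).1] at h1
      rw [fadLevMat_succ, ← h1]
      abel
  exact ⟨hmat, hcoeff r hr hmat⟩

theorem fadLevCoeff_last (N : Matrix (Fin n) (Fin n) ℤ) (hn : 0 < n) :
    fadLevCoeff N (n - 1) = N.det := by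
  rw [(fadLev_eq N (n - 1) (by omega)).2.1, Nat.sub_self, coeff_zero_eq_eval_zero,
    Matrix.eval_charpoly]
  simp

theorem fadLevMat_last (N : Matrix (Fin n) (Fin n) ℤ) (hn : 0 < n) :
    fadLevMat N (n - 1) = N.adjugate := by
  have h : (-N).charmatrix.map (evalRingHom 0) = N := by
    ext i j
    rcases eq_or_ne i j with rfl | h
    · simp [Matrix.charmatrix_apply_eq]
    · simp [Matrix.charmatrix_apply_ne _ _ _ h]
  rw [(fadLev_eq N (n - 1) (by omega)).1, Nat.sub_self]
  conv_rhs => rw [← h]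
  have h2 := (evalRingHom (0 : ℤ)).map_adjugate (-N).charmatrix
  rw [RingHom.mapMatrix_apply, RingHom.mapMatrix_apply] at h2
  rw [← h2]
  ext i j
  simp [adjCoeff, coeff_zero_eq_eval_zero]

/-- Together with `fadLevMat N 0 = 1` this ensures that the recursion has a last non-zero matrix. -/
theorem fadLevMat_self (N : Matrix (Fin n) (Fin n) ℤ) (hn : 0 < n) : fadLevMat N n = 0 := by
  obtain ⟨m, rfl⟩ : ∃ m, n = m + 1 := ⟨n - 1, by omega⟩
  have h1 := fadLevMat_last N hn
  have h2 := fadLevCoeff_last N hn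
  rw [Nat.add_sub_cancel] at h1 h2
  rw [fadLevMat_succ, h1, h2, Matrix.mul_adjugate, sub_self]

/-- If `N` is singular, the last non-zero matrix of the recursion is annihilated by `N`. -/
theorem mul_fadLevMat_eq_zero (N : Matrix (Fin n) (Fin n) ℤ) (hN : N.det = 0) {r : ℕ} (hr : r < n)
    (h : fadLevMat N (r + 1) = 0) : N * fadLevMat N r = 0 := by
  have hc : fadLevCoeff N r = 0 := by
    -- The trace of `c • 1 - N * P_r = 0` reads `(n - (r + 1)) * c = 0`. This settles everything
    -- except `r + 1 = n`, where `c` is the determinant.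
    rcases eq_or_ne (r + 1) n with hrn | hrn
    · obtain rfl : r = n - 1 := by omega
      rw [fadLevCoeff_last N (by omega), hN]
    · have h1 := congrArg Matrix.trace h
      rw [fadLevMat_succ, Matrix.trace_sub, Matrix.trace_smul, Matrix.trace_one,
        (fadLev_eq N r hr).2.2, Fintype.card_fin, Matrix.trace_zero, smul_eq_mul] at h1
      have h2 : ((n : ℤ) - (r + 1)) * fadLevCoeff N r = 0 := by linear_combination h1
      refine (mul_eq_zero.1 h2).resolve_left ?_
      omega
  rw [fadLevMat_succ, hc, zero_smul, zero_sub, neg_eq_zero] at h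
  exact h

end FaddeevLeVerrier

/-! ### Sign-reversing vectors from minors -/

section Conversion

variable {n : ℕ}

/-- The matrix with rows `A i` for `i ∈ α` with `i < k`, and unit rows otherwise. -/
def rowMask (A : Matrix (Fin n) (Fin n) ℤ) (α : Finset (Fin n)) (k : ℕ) :
    Matrix (Fin n) (Fin n) ℤ :=
  fun i j => if i ∈ α ∧ (i : ℕ) < k then A i j else (1 : Matrix (Fin n) (Fin n) ℤ) i j

theorem rowMask_zero (A : Matrix (Fin n) (Fin n) ℤ) (α : Finset (Fin n)) :
    rowMask A α 0 = 1 := by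
  ext i j
  simp [rowMask]

theorem rowMask_succ_of_notMem (A : Matrix (Fin n) (Fin n) ℤ) {α : Finset (Fin n)} {j : Fin n}
    (hj : j ∉ α) : rowMask A α (j + 1) = rowMask A α j := by
  ext i m
  have : i ∈ α ∧ (i : ℕ) < j + 1 ↔ i ∈ α ∧ (i : ℕ) < j := by
    constructor
    · rintro ⟨h, h'⟩
      refine ⟨h, lt_of_le_of_ne (Nat.lt_succ_iff.1 h') fun h'' => hj ?_⟩
      rwa [← Fin.ext h'']
    · rintro ⟨h, h'⟩
      exact ⟨h, by omega⟩
  simp only [rowMask, this]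

/-- Consequently the cofactor at `(j, j)` of one masked matrix is the determinant of the preceding
one. -/
theorem updateRow_rowMask_succ (A : Matrix (Fin n) (Fin n) ℤ) (α : Finset (Fin n)) (j : Fin n) :
    (rowMask A α (j + 1)).updateRow j (Pi.single j 1) = rowMask A α j := by
  ext i m
  rcases eq_or_ne i j with rfl | h
  · simp [rowMask, Matrix.one_apply, Pi.single_apply, eq_comm]
  · have h' : (i : ℕ) ≠ j := fun h' => h (Fin.ext h')
    have : (i : ℕ) < j + 1 ↔ (i : ℕ) < j := by omega
    rw [Matrix.updateRow_ne h]
    simp only [rowMask, this]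

theorem rowMask_mulVec (A : Matrix (Fin n) (Fin n) ℤ) (α : Finset (Fin n)) (k : ℕ) (x : Fin n → ℤ)
    (i : Fin n) :
    (rowMask A α k *ᵥ x) i = if i ∈ α ∧ (i : ℕ) < k then (A *ᵥ x) i else x i := by
  split_ifs with h
  · simp [Matrix.mulVec, dotProduct, rowMask, h]
  · simp only [Matrix.mulVec, dotProduct, rowMask, if_neg h]
    exact congrFun (Matrix.one_mulVec x) i

/-- Rows outside `α` are unit rows, so the matrix is block triangular with blocks `L • M|_α` and
`1`. Masking thus treats principal minors without changing the dimension. -/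
theorem det_rowMask {R : Type*} [Field R] [LinearOrder R] (A : Matrix (Fin n) (Fin n) ℤ)
    (α : Finset (Fin n)) (M : Matrix (Fin n) (Fin n) R) (L : R)
    (hA : ∀ i j, (A i j : R) = L * M i j) :
    ((rowMask A α n).det : R) = L ^ α.card * (principal M α).det := by
  have h1 : ((rowMask A α n).det : R) = ((rowMask A α n).map (Int.cast : ℤ → R)).det :=
    (Int.castRingHom R).map_det _
  rw [h1, Matrix.twoBlockTriangular_det _ (fun i => i ∈ α)]
  · have h2 : Matrix.toSquareBlockProp ((rowMask A α n).map (Int.cast : ℤ → R)) (fun i => i ∈ α) =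
        L • principal M α := by
      ext i j
      simp [Matrix.toSquareBlockProp_def, rowMask, principal, hA]
    have h3 : Matrix.toSquareBlockProp ((rowMask A α n).map (Int.cast : ℤ → R))
        (fun i => ¬ i ∈ α) = 1 := by
      ext i j
      simp [Matrix.toSquareBlockProp_def, rowMask, i.2, Matrix.one_apply, Subtype.ext_iff]
    have h4 : (L • principal M α).det = L ^ α.card * (principal M α).det := by
      rw [Matrix.det_smul, Fintype.card_coe]
    rw [h3, Matrix.det_one, mul_one, h2, ← h4]
    congr!
  · intro i hi j hj
    have hij : i ≠ j := fun h => hi (h ▸ hj)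
    simp [rowMask, hi, Matrix.one_apply_ne hij]

theorem padZero_of_support {R : Type*} [Field R] {α : Finset (Fin n)} {x : Fin n → R}
    (hx : ∀ i ∉ α, x i = 0) : padZero α (fun i : α => x i) = x := by
  ext i
  by_cases h : i ∈ α
  · simp [padZero, h]
  · simp [padZero, h, hx i h]

theorem mulVec_padZero {R : Type*} [Field R] [LinearOrder R] (M : Matrix (Fin n) (Fin n) R)
    (α : Finset (Fin n)) (y : α → R) (i : α) :
    (M *ᵥ padZero α y) i = (principal M α *ᵥ y) i := by
  simp only [Matrix.mulVec, dotProduct, principal, Matrix.submatrix_apply]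
  rw [← Finset.sum_subset (Finset.subset_univ α), ← Finset.sum_coe_sort]
  · simp [padZero]
  · intro j _ hj
    simp [padZero, hj]

/-- The output of the conversion: an integer vector supported on `α` that is a kernel vector of
the masked matrix if that matrix is singular, and sign-reversing in any case. -/
structure IsConversion (A : Matrix (Fin n) (Fin n) ℤ) (α : Finset (Fin n)) (x : Fin n → ℤ) :
    Prop where
  ne_zero : x ≠ 0
  eq_zero_of_notMem : ∀ i ∉ α, x i = 0
  mul_nonpos : ∀ i, x i * (A *ᵥ x) i ≤ 0
  kernel : (rowMask A α n).det = 0 → ∀ i ∈ α, (A *ᵥ x) i = 0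

theorem isConversion_of_kernel {A : Matrix (Fin n) (Fin n) ℤ} {α : Finset (Fin n)}
    {x : Fin n → ℤ} (hx : x ≠ 0) (h : rowMask A α n *ᵥ x = 0) : IsConversion A α x := by
  have h0 : ∀ i ∉ α, x i = 0 := fun i hi => by
    simpa [rowMask_mulVec, hi] using congrFun h i
  have h1 : ∀ i ∈ α, (A *ᵥ x) i = 0 := fun i hi => by
    simpa [rowMask_mulVec, hi] using congrFun h i
  refine ⟨hx, h0, fun i => ?_, fun _ => h1⟩
  by_cases hi : i ∈ α
  · simp [h1 i hi]
  · simp [h0 i hi]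

/-- Cramer's rule: `rowMask A α (j + 1)` maps `x` to `det • e_j`. Rows of `A` other than `j`
therefore give `(A x)_i = 0`, unit rows give `x_i = 0`, and in row `j` a positive `x_j` meets a
non-positive determinant. -/
theorem isConversion_of_adjugate {A : Matrix (Fin n) (Fin n) ℤ} {α : Finset (Fin n)}
    {x : Fin n → ℤ} (hdet : (rowMask A α n).det ≠ 0) (j : Fin n)
    (hpos : 0 < (rowMask A α j).det) (hneg : (rowMask A α (j + 1)).det ≤ 0)
    (hx : ∀ i, x i = (rowMask A α (j + 1)).adjugate i j) : IsConversion A α x := by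
  have hj : j ∈ α := by
    by_contra hj
    rw [rowMask_succ_of_notMem A hj] at hneg
    omega
  have hxj : 0 < x j := by
    rwa [hx, Matrix.adjugate_apply, updateRow_rowMask_succ]
  have hmul : ∀ i, (rowMask A α (j + 1) *ᵥ x) i =
      if i = j then (rowMask A α (j + 1)).det else 0 := by
    intro i
    have h := congrArg (fun B : Matrix (Fin n) (Fin n) ℤ => B i j)
      (Matrix.mul_adjugate (rowMask A α (j + 1)))
    simpa [Matrix.mul_apply, Matrix.mulVec, dotProduct, hx, Matrix.one_apply] using h
  have hoff : ∀ i, ¬ (i ∈ α ∧ (i : ℕ) < j + 1) → x i = 0 := by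
    intro i hi
    have hij : i ≠ j := by
      rintro rfl
      exact hi ⟨hj, Nat.lt_succ_self _⟩
    have h := hmul i
    rwa [rowMask_mulVec, if_neg hi, if_neg hij] at h
  refine ⟨fun h => by simp [h] at hxj, fun i hi => hoff i fun h => hi h.1, fun i => ?_,
    fun h => absurd h hdet⟩
  by_cases hi : i ∈ α ∧ (i : ℕ) < j + 1
  · have h := hmul i
    rw [rowMask_mulVec, if_pos hi] at h
    rw [h]
    split_ifs with hij
    · subst hij
      exact mul_nonpos_of_nonneg_of_nonpos hxj.le hneg
    · simp
  · simp [hoff i hi]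

theorem IsConversion.spec {A : Matrix (Fin n) (Fin n) ℤ} {α : Finset (Fin n)} {x : Fin n → ℤ}
    (h : IsConversion A α x) {M : Matrix (Fin n) (Fin n) ℚ} {L : ℚ} (hL : 0 < L)
    (hA : ∀ i j, (A i j : ℚ) = L * M i j) :
    padZero α (fun i : α => (x i : ℚ)) = (fun i => (x i : ℚ)) ∧
      IsSignReversing M (fun i => (x i : ℚ)) ∧
      ((principal M α).det = 0 → principal M α *ᵥ (fun i : α => (x i : ℚ)) = 0) := by
  have hpad : padZero α (fun i : α => (x i : ℚ)) = (fun i => (x i : ℚ)) :=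
    padZero_of_support (x := fun i => (x i : ℚ)) fun i hi => by simp [h.eq_zero_of_notMem i hi]
  have hmul : ∀ i, (((A *ᵥ x) i : ℤ) : ℚ) = L * (M *ᵥ fun i => (x i : ℚ)) i := by
    intro i
    simp only [Matrix.mulVec, dotProduct, Int.cast_sum, Int.cast_mul, hA, Finset.mul_sum, mul_assoc]
  refine ⟨hpad, ⟨fun h0 => h.ne_zero ?_, fun i => ?_⟩, fun hdet => ?_⟩
  · ext i
    simpa using congrFun h0 i
  · have h1 : ((x i * (A *ᵥ x) i : ℤ) : ℚ) ≤ 0 := by exact_mod_cast h.mul_nonpos i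
    rw [Int.cast_mul, hmul, mul_left_comm] at h1
    exact nonpos_of_mul_nonpos_right h1 hL
  · have h0 : (rowMask A α n).det = 0 := by
      have := det_rowMask A α M L hA
      rw [hdet, mul_zero] at this
      exact_mod_cast this
    ext i
    rw [← mulVec_padZero, hpad]
    have h1 := hmul i
    rw [h.kernel h0 i i.2, Int.cast_zero] at h1
    simpa [hL.ne'] using h1.symm

/-! ### Kernel vectors and eigenvectors over the reals -/

/-- On `α` the product is `μ * y_i ^ 2`, and outside `α` it vanishes. The case `μ = 0` covers kernel
vectors. -/
theorem isSignReversing_padZero {R : Type*} [Field R] [LinearOrder R] [IsStrictOrderedRing R]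
    {M : Matrix (Fin n) (Fin n) R} {α : Finset (Fin n)} {y : α → R} {μ : R} (hy : y ≠ 0)
    (hμ : μ ≤ 0) (h : principal M α *ᵥ y = μ • y) : IsSignReversing M (padZero α y) := by
  refine ⟨fun h0 => hy ?_, fun i => ?_⟩
  · ext i
    simpa [padZero] using congrFun h0 i
  · by_cases hi : i ∈ α
    · have h1 := mulVec_padZero M α y ⟨i, hi⟩
      simp only [h, Pi.smul_apply, smul_eq_mul] at h1
      rw [h1]
      simp only [padZero, hi, dite_true]
      rw [mul_left_comm]
      exact mul_nonpos_of_nonpos_of_nonneg hμ (mul_self_nonneg _)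
    · simp [padZero, hi]

/-- The monic polynomial `det (t + A)` is negative at `t = 0` and tends to infinity, so it has a
root `t > 0`, and `-t` is an eigenvalue of `A`. -/
theorem exists_neg_eigenvector_of_det_neg {ι : Type*} [Fintype ι] [DecidableEq ι]
    (A : Matrix ι ι ℝ) (hA : A.det < 0) :
    ∃ μ : ℝ, μ < 0 ∧ ∃ y : ι → ℝ, Module.End.HasEigenvector (Matrix.toLin' A) μ y := by
  have hne : Nonempty ι := by
    by_contra h
    rw [not_nonempty_iff] at h
    rw [Matrix.det_isEmpty] at hA
    linarith
  have hdeg : 0 < (-A).charpoly.degree := by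
    rw [Matrix.charpoly_degree_eq_dim]
    exact_mod_cast Fintype.card_pos
  have htop := Polynomial.tendsto_atTop_of_leadingCoeff_nonneg (-A).charpoly hdeg
    (by rw [(-A).charpoly_monic.leadingCoeff]; exact zero_le_one)
  obtain ⟨b, hb0, hb⟩ := ((Filter.eventually_ge_atTop (0 : ℝ)).and
    (htop.eventually_ge_atTop 0)).exists
  have h0 : (-A).charpoly.eval 0 = A.det := by
    rw [Matrix.eval_charpoly]
    simp
  obtain ⟨t, ht, hroot⟩ := intermediate_value_Icc hb0 (-A).charpoly.continuous.continuousOn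
    (show (0 : ℝ) ∈ Set.Icc ((-A).charpoly.eval 0) ((-A).charpoly.eval b) from
      ⟨by rw [h0]; exact hA.le, hb⟩)
  have ht0 : t ≠ 0 := by
    rintro rfl
    simp only [h0] at hroot
    linarith
  have htpos : 0 < t := lt_of_le_of_ne ht.1 ht0.symm
  simp only [Matrix.eval_charpoly, sub_neg_eq_add] at hroot
  obtain ⟨y, hy, hmul⟩ := Matrix.exists_mulVec_eq_zero_iff.2 hroot
  refine ⟨-t, by linarith, y, ?_⟩
  rw [Module.End.hasEigenvector_iff, Module.End.mem_eigenspace_iff]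
  refine ⟨?_, hy⟩
  rw [Matrix.add_mulVec, Matrix.scalar_apply, ← Matrix.smul_one_eq_diagonal, Matrix.smul_mulVec,
    Matrix.one_mulVec] at hmul
  rw [Matrix.toLin'_apply, neg_smul]
  exact eq_neg_of_add_eq_zero_right hmul

end Conversion

/-! ### Loops that fill an array or compute a sum -/

/-- Fill the cells of array `a` from the value of `o` on: in round `v` run `c` and write the value
of `e`. -/
def RamProg.fill (v a : ℕ) (b o : RamExpr) (c : RamProg) (e : RamExpr) : RamProg :=
  .forLoop v b (.seq c (.write a (.add o (.var v)) e))

/-- Store in `acc` the sum of the values of `e` over the rounds `v` below the value of `b`. -/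
def RamProg.sum (acc v : ℕ) (b e : RamExpr) : RamProg :=
  .seq (.assign acc (.const 0)) (.forLoop v b (.assign acc (.add (.var acc) e)))

namespace RamProg.WP

variable {N : ℕ} {s : RamMemory} {Q : RamMemory → Prop}

/-- In `hc` nothing is known about array `a`, so each value must be computable without the cells
filled so far. In return no invariant has to be supplied. -/
theorem fill {v a : ℕ} {b o : RamExpr} {c : RamProg} {e : RamExpr} {k : ℕ} (z : ℤ)
    (f : Fin k → ℤ) (hk : k ≤ N) (hva : v ≠ a) (hv : v ∉ c.writes) (ha : a ∉ c.writes)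
    (hb : ∀ s' : RamMemory, (∀ x, x ≠ v → x ≠ a → x ∉ c.writes → s' x = s x) → b.eval s' = k)
    (ho : ∀ s' : RamMemory, (∀ x, x ≠ v → x ≠ a → x ∉ c.writes → s' x = s x) → o.eval s' = z)
    (hf : ∀ t, (f t).natAbs < 2 ^ N)
    (hc : ∀ t : Fin k, ∀ s' : RamMemory, (∀ x, x ≠ v → x ≠ a → x ∉ c.writes → s' x = s x) →
      s' v 0 = (t : ℕ) → c.WP N s' fun s'' => e.eval s'' = f t)
    (hQ : ∀ s' : RamMemory, (∀ x, x ≠ v → x ≠ a → x ∉ c.writes → s' x = s x) →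
      (∀ t : Fin k, s' a (z + (t : ℕ)) = f t) →
      (∀ y, y < z ∨ z + k ≤ y → s' a y = s a y) → Q s') :
    (RamProg.fill v a b o c e).WP N s Q := by
  have hw : ∀ x, x ∉ (RamProg.seq c (.write a (.add o (.var v)) e)).writes ↔
      x ∉ c.writes ∧ x ≠ a := by
    intro x
    simp [RamProg.writes]
  refine .forLoop (fun i s' => (∀ t : Fin k, (t : ℕ) < i → s' a (z + (t : ℕ)) = f t) ∧
    ∀ y, y < z ∨ z + k ≤ y → s' a y = s a y) k hk ((hw v).2 ⟨hv, hva⟩) ?_ ?_ ?_ ?_ ?_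
  · rintro i s' s'' h ⟨h1, h2⟩
    rw [h a hva.symm]
    exact ⟨h1, h2⟩
  · exact fun s' h => hb s' fun x h1 h2 h3 => h x h1 ((hw x).2 ⟨h3, h2⟩)
  · exact ⟨fun t ht => absurd ht (Nat.not_lt_zero _), fun _ _ => rfl⟩
  · rintro i hi s' hfr hvi ⟨h1, h2⟩
    have hfr' : ∀ x, x ≠ v → x ≠ a → x ∉ c.writes → s' x = s x :=
      fun x h1 h2 h3 => hfr x h1 ((hw x).2 ⟨h3, h2⟩)
    refine .seq ((hc ⟨i, hi⟩ s' hfr' hvi).mono fun s2 hs2 he => ?_)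
    have ho2 : o.eval s2 = z := ho s2 fun x h1 h2 h3 => by rw [hs2 x h3, hfr' x h1 h2 h3]
    have hv2 : s2 v 0 = i := by rw [hs2 v hv, hvi]
    refine .write (by rw [he]; exact hf _) ⟨fun t ht => ?_, fun y hy => ?_⟩
    · rw [Function.update_self, Function.update_apply, he, RamExpr.eval_add, RamExpr.eval_var, ho2,
        hv2]
      split_ifs with hti
      · congr 1
        ext
        simp only
        omega
      · rw [hs2 a ha]
        exact h1 t (by omega)
    · rw [Function.update_self, Function.update_of_ne, hs2 a ha, h2 y hy]
      rw [RamExpr.eval_add, RamExpr.eval_var, ho2, hv2]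
      omega
  · rintro s' hfr ⟨h1, h2⟩
    exact hQ s' (fun x h1 h2 h3 => hfr x h1 ((hw x).2 ⟨h3, h2⟩)) (fun t => h1 t t.2) h2

theorem fillMat {v a : ℕ} {b o : RamExpr} {c : RamProg} {e : RamExpr} {n : ℕ} (z : ℤ)
    (F : Fin n → Fin n → ℤ) (hk : n * n ≤ N) (hva : v ≠ a) (hv : v ∉ c.writes)
    (ha : a ∉ c.writes)
    (hb : ∀ s' : RamMemory, (∀ x, x ≠ v → x ≠ a → x ∉ c.writes → s' x = s x) →
      b.eval s' = (n * n : ℕ))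
    (ho : ∀ s' : RamMemory, (∀ x, x ≠ v → x ≠ a → x ∉ c.writes → s' x = s x) → o.eval s' = z)
    (hf : ∀ i j, (F i j).natAbs < 2 ^ N)
    (hc : ∀ i j : Fin n, ∀ s' : RamMemory,
      (∀ x, x ≠ v → x ≠ a → x ∉ c.writes → s' x = s x) →
      s' v 0 = ((i : ℕ) : ℤ) * n + (j : ℕ) → c.WP N s' fun s'' => e.eval s'' = F i j)
    (hQ : ∀ s' : RamMemory, (∀ x, x ≠ v → x ≠ a → x ∉ c.writes → s' x = s x) →
      (∀ i j : Fin n, s' a (z + (((i : ℕ) : ℤ) * n + (j : ℕ))) = F i j) →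
      (∀ y, y < z → s' a y = s a y) → Q s') :
    (RamProg.fill v a b o c e).WP N s Q := by
  refine .fill z (fun t : Fin (n * n) => F t.divNat t.modNat) hk hva hv ha hb ho
    (fun _ => hf _ _) (fun t s' h1 h2 => hc _ _ s' h1 ?_) (fun s' h1 h2 h3 => hQ s' h1 ?_ fun y hy => h3 y (.inl hy))
  · rw [h2]
    have := Nat.div_add_mod' (t : ℕ) n
    simp only [Fin.coe_divNat, Fin.coe_modNat]
    exact_mod_cast this.symm
  · intro i j
    have h4 := h2 (finProdFinEquiv (i, j))
    have h5 := finProdFinEquiv.symm_apply_apply (i, j)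
    simp only [finProdFinEquiv_symm_apply, Prod.mk.injEq] at h5
    rw [h5.1, h5.2] at h4
    rw [← h4]
    congr 2
    simp only [finProdFinEquiv_apply_val]
    push_cast
    ring

/-- `C` bounds the summands, so `k * C` bounds every partial sum, and these are what the accumulator
has to hold. -/
theorem sum {acc v : ℕ} {b e : RamExpr} {k : ℕ} (f : Fin k → ℤ) (C : ℕ) (hk : k ≤ N)
    (hva : v ≠ acc)
    (hb : ∀ s' : RamMemory, (∀ x, x ≠ v → x ≠ acc → s' x = s x) → b.eval s' = k)
    (he : ∀ t : Fin k, ∀ s' : RamMemory, (∀ x, x ≠ v → x ≠ acc → s' x = s x) →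
      s' v 0 = (t : ℕ) → e.eval s' = f t)
    (hf : ∀ t, (f t).natAbs ≤ C) (hC : k * C < 2 ^ N)
    (hQ : ∀ s' : RamMemory, (∀ x, x ≠ v → x ≠ acc → s' x = s x) → s' acc 0 = ∑ t, f t → Q s') :
    (RamProg.sum acc v b e).WP N s Q := by
  set g : ℕ → ℤ := fun t => if h : t < k then f ⟨t, h⟩ else 0 with hg
  have hgk : ∑ t, f t = ∑ t ∈ Finset.range k, g t := by
    rw [Finset.sum_range]
    simp [hg]
  have hbound : ∀ i ≤ k, (∑ t ∈ Finset.range i, g t).natAbs < 2 ^ N := by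
    intro i hi
    refine lt_of_le_of_lt ((Int.natAbs_sum_le _ _).trans ?_) hC
    refine (Finset.sum_le_card_nsmul _ _ C fun t ht => ?_).trans ?_
    · simp only [hg]
      split_ifs
      · exact hf _
      · simp
    · rw [Finset.card_range, smul_eq_mul]
      gcongr
  have hw : ∀ x, x ∉ (RamProg.assign acc (.add (.var acc) e)).writes ↔ x ≠ acc := by
    intro x
    simp [RamProg.assign, RamProg.writes]
  refine .seq (.assign (by simp) fun s1 hs1 hs10 => ?_)
  have hfr' : ∀ s' : RamMemory, (∀ x, x ≠ v →
      x ∉ (RamProg.assign acc (.add (.var acc) e)).writes → s' x = s1 x) →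
      ∀ x, x ≠ v → x ≠ acc → s' x = s x := by
    intro s' h x h1 h2
    rw [h x h1 ((hw x).2 h2), hs1 x h2]
  refine .forLoop (fun i s' => s' acc 0 = ∑ t ∈ Finset.range i, g t) k hk ((hw v).2 hva)
    ?_ ?_ ?_ ?_ ?_
  · intro i s' s'' h h1
    rw [h acc hva.symm, h1]
  · exact fun s' h => hb s' (hfr' s' h)
  · simpa using hs10
  · intro i hi s' hfr hvi hI
    have hval : (RamExpr.add (.var acc) e).eval s' = ∑ t ∈ Finset.range (i + 1), g t := by
      rw [RamExpr.eval_add, RamExpr.eval_var, hI, he ⟨i, hi⟩ s' (hfr' s' hfr) hvi,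
        Finset.sum_range_succ]
      simp [hg, hi]
    exact .assign (by rw [hval]; exact hbound _ hi) fun s2 _ h2 => by rw [h2, hval]
  · exact fun s' hfr hI => hQ s' (hfr' s' hfr) (by rw [hI, hgk])

end RamProg.WP

/-! ### Expressions for matrix entries -/

/-- Square of the dimension. -/
def RamExpr.dimSq : RamExpr := .mul (.var 0) (.var 0)

/-- Row of the cell whose number is in variable `v`. -/
def RamExpr.row (v : ℕ) : RamExpr := .div (.var v) (.var 0)

/-- Column of the cell whose number is in variable `v`. -/
def RamExpr.col (v : ℕ) : RamExpr := .sub (.var v) (.mul (.row v) (.var 0))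

/-- Kronecker delta. -/
def RamExpr.delta (e f : RamExpr) : RamExpr :=
  .div (.const 1) (.add (.const 1) (.mul (.sub e f) (.sub e f)))

theorem RamExpr.eval_dimSq {s : RamMemory} {n : ℕ} (h : s 0 0 = n) :
    RamExpr.dimSq.eval s = (n * n : ℕ) := by
  simp [RamExpr.dimSq, h]

/-- The row `i` is an arbitrary integer, so that the expressions also decode cells in a stack of
several `n × n` blocks. -/
theorem RamExpr.eval_row {s : RamMemory} {n v : ℕ} (h : s 0 0 = n) {i : ℤ} {j : Fin n}
    (hv : s v 0 = i * n + (j : ℕ)) : (RamExpr.row v).eval s = i := by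
  have hn : (0 : ℤ) < n := by exact_mod_cast j.pos
  rw [RamExpr.row, RamExpr.eval_div, RamExpr.eval_var, RamExpr.eval_var, h, hv, add_comm,
    Int.add_mul_ediv_right _ _ hn.ne', Int.ediv_eq_zero_of_lt (by omega) (by omega), zero_add]

theorem RamExpr.eval_col {s : RamMemory} {n v : ℕ} (h : s 0 0 = n) {i : ℤ} {j : Fin n}
    (hv : s v 0 = i * n + (j : ℕ)) : (RamExpr.col v).eval s = (j : ℕ) := by
  rw [RamExpr.col, RamExpr.eval_sub, RamExpr.eval_mul, RamExpr.eval_row h hv, RamExpr.eval_var,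
    RamExpr.eval_var, h, hv]
  ring

/-- The integer quotient of `1` by `1 + d ^ 2` is `1` for `d = 0` and `0` otherwise. -/
theorem RamExpr.eval_delta {s : RamMemory} {n : ℕ} {e f : RamExpr} {i j : Fin n}
    (he : e.eval s = (i : ℕ)) (hf : f.eval s = (j : ℕ)) :
    (RamExpr.delta e f).eval s = (1 : Matrix (Fin n) (Fin n) ℤ) i j := by
  simp only [RamExpr.delta, RamExpr.eval_div, RamExpr.eval_const, RamExpr.eval_add,
    RamExpr.eval_mul, RamExpr.eval_sub, he, hf]
  rcases eq_or_ne i j with rfl | h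
  · simp
  · have h1 : ((i : ℕ) : ℤ) - (j : ℕ) ≠ 0 := fun h' => h (Fin.ext (by omega))
    rw [Matrix.one_apply_ne h]
    exact Int.ediv_eq_zero_of_lt zero_le_one (by nlinarith [mul_self_pos.2 h1])

/-! ### The Faddeev–LeVerrier program -/

section FaddeevLeVerrierProgram

variable {n : ℕ}

theorem natAbs_mul_apply_le {X P : Matrix (Fin n) (Fin n) ℤ} {b c : ℕ}
    (hX : ∀ i j, (X i j).natAbs ≤ b) (hP : ∀ i j, (P i j).natAbs ≤ c) (i j : Fin n) :
    ((X * P) i j).natAbs ≤ n * (b * c) := by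
  rw [Matrix.mul_apply]
  refine (Int.natAbs_sum_le _ _).trans ((Finset.sum_le_card_nsmul _ _ (b * c) fun m _ => ?_).trans
    (by simp))
  rw [Int.natAbs_mul]
  exact Nat.mul_le_mul (hX _ _) (hP _ _)

theorem natAbs_trace_mul_le {X P : Matrix (Fin n) (Fin n) ℤ} {b c : ℕ}
    (hX : ∀ i j, (X i j).natAbs ≤ b) (hP : ∀ i j, (P i j).natAbs ≤ c) :
    ((X * P).trace).natAbs ≤ n * (n * (b * c)) := by
  refine (Int.natAbs_sum_le _ _).trans ((Finset.sum_le_card_nsmul _ _ (n * (b * c))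
    fun m _ => ?_).trans (by simp))
  exact natAbs_mul_apply_le hX hP m m

/-- Each round multiplies the bound by at most `n * n * b` (trace term) plus `n * b` (product term).
This crude estimate already keeps the bit lengths polynomial. -/
theorem natAbs_fadLevMat_le {X : Matrix (Fin n) (Fin n) ℤ} {b G : ℕ}
    (hX : ∀ i j, (X i j).natAbs ≤ b) (hG : n * n * b + n * b ≤ G) (r : ℕ) (i j : Fin n) :
    (fadLevMat X r i j).natAbs ≤ G ^ r := by
  induction r generalizing i j with
  | zero =>
    rw [fadLevMat, Matrix.one_apply]
    split_ifs <;> simp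
  | succ r ih =>
    have h1 := natAbs_mul_apply_le hX ih i j
    have h2 := natAbs_trace_mul_le hX ih
    have h3 : (fadLevCoeff X r).natAbs ≤ n * (n * (b * G ^ r)) :=
      (Int.natAbs_ediv_le_natAbs _ _).trans h2
    have h4 : (fadLevMat X (r + 1) i j).natAbs ≤
        (fadLevCoeff X r).natAbs + ((X * fadLevMat X r) i j).natAbs := by
      rw [fadLevMat_succ, Matrix.sub_apply, Matrix.smul_apply, Matrix.one_apply, smul_eq_mul]
      refine (Int.natAbs_sub_le _ _).trans ?_
      split_ifs <;> simp
    have h5 := Nat.mul_le_mul_right (G ^ r) hG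
    rw [pow_succ']
    calc (fadLevMat X (r + 1) i j).natAbs
        ≤ n * (n * (b * G ^ r)) + n * (b * G ^ r) := h4.trans (add_le_add h3 h1)
      _ = (n * n * b + n * b) * G ^ r := by ring
      _ ≤ G * G ^ r := h5

/-- Array `11` becomes the product of array `9` and block `r` of array `10`. -/
def progProd : RamProg :=
  .fill 14 11 .dimSq (.const 0)
    (.sum 13 15 (.var 0) (.mul (.read 9 (.add (.mul (.row 14) (.var 0)) (.var 15)))
      (.read 10 (.add (.mul (.var 18) .dimSq) (.add (.mul (.var 15) (.var 0)) (.col 14))))))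
    (.var 13)

/-- Variable `12` becomes the coefficient of round `r`, the trace of array `11` over `r + 1`. -/
def progCoeff : RamProg :=
  .seq (.sum 13 15 (.var 0) (.read 11 (.add (.mul (.var 15) (.var 0)) (.var 15))))
    (.assign 12 (.div (.var 13) (.add (.var 18) (.const 1))))

/-- Block `r + 1` of array `10` is computed. -/
def progStep : RamProg :=
  .fill 14 10 .dimSq (.mul (.add (.var 18) (.const 1)) .dimSq) .skip
    (.sub (.mul (.var 12) (.delta (.row 14) (.col 14))) (.read 11 (.var 14)))

/-- The Faddeev–LeVerrier recursion for the matrix in array `9`. -/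
def progFadLev : RamProg :=
  .seq (.fill 14 10 .dimSq (.const 0) .skip (.delta (.row 14) (.col 14)))
    (.forLoop 18 (.var 0) (.seq progProd (.seq progCoeff progStep)))

variable {N : ℕ} {s : RamMemory} {Q : RamMemory → Prop}

theorem wp_progProd {X P : Matrix (Fin n) (Fin n) ℤ} {r b c : ℕ} (h0 : s 0 0 = n)
    (h18 : s 18 0 = r)
    (h9 : ∀ i j : Fin n, s 9 (((i : ℕ) : ℤ) * n + (j : ℕ)) = X i j)
    (h10 : ∀ i j : Fin n, s 10 ((r : ℤ) * (n * n : ℕ) + (((i : ℕ) : ℤ) * n + (j : ℕ))) = P i j)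
    (hX : ∀ i j, (X i j).natAbs ≤ b) (hP : ∀ i j, (P i j).natAbs ≤ c)
    (hn : n * n ≤ N) (hN : n * (b * c) < 2 ^ N)
    (hQ : ∀ s' : RamMemory, (∀ x ∉ [11, 13, 14, 15], s' x = s x) →
      (∀ i j : Fin n, s' 11 (((i : ℕ) : ℤ) * n + (j : ℕ)) = (X * P) i j) → Q s') :
    progProd.WP N s Q := by
  refine .fillMat 0 (fun i j => (X * P) i j) hn (by decide) (by decide) (by decide)
    (fun s' h => RamExpr.eval_dimSq ?_) (fun _ _ => rfl)
    (fun i j => (natAbs_mul_apply_le hX hP i j).trans_lt hN) ?_ ?_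
  · rw [h 0 (by decide) (by decide) (by decide), h0]
  · intro i j s' h h14
    have h0' : s' 0 0 = n := by rw [h 0 (by decide) (by decide) (by decide), h0]
    refine .sum (fun m => X i m * P m j) (b * c) ((Nat.le_mul_self n).trans hn) (by decide)
      (fun s2 h2 => ?_) (fun m s2 h2 hm => ?_) (fun m => ?_) hN (fun s2 h2 hs2 => ?_)
    · rw [RamExpr.eval_var, h2 0 (by decide) (by decide), h0']
    · have h02 : s2 0 0 = n := by rw [h2 0 (by decide) (by decide), h0']
      have h142 : s2 14 0 = ((i : ℕ) : ℤ) * n + (j : ℕ) := by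
        rw [h2 14 (by decide) (by decide), h14]
      have h182 : s2 18 0 = r := by
        rw [h2 18 (by decide) (by decide), h 18 (by decide) (by decide) (by decide), h18]
      have h92 : s2 9 = s 9 := by
        rw [h2 9 (by decide) (by decide), h 9 (by decide) (by decide) (by decide)]
      have h102 : s2 10 = s 10 := by
        rw [h2 10 (by decide) (by decide), h 10 (by decide) (by decide) (by decide)]
      simp only [RamExpr.eval_mul, RamExpr.eval_read, RamExpr.eval_add, RamExpr.eval_var,
        RamExpr.eval_row h02 h142, RamExpr.eval_col h02 h142, RamExpr.eval_dimSq h02, h02, hm,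
        h182, h92, h102]
      rw [h9, h10]
    · rw [Int.natAbs_mul]
      exact Nat.mul_le_mul (hX _ _) (hP _ _)
    · rw [RamExpr.eval_var, hs2, Matrix.mul_apply]
  · intro s' h h1 _
    refine hQ s' (fun x hx => ?_) (by simpa using h1)
    simp only [List.mem_cons, List.not_mem_nil, not_or, or_false] at hx
    refine h x (by tauto) (by tauto) ?_
    simp [RamProg.sum, RamProg.forLoop, RamProg.assign, RamProg.writes]
    tauto

theorem wp_progCoeff {X P : Matrix (Fin n) (Fin n) ℤ} {r b c : ℕ} (h0 : s 0 0 = n)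
    (h18 : s 18 0 = r)
    (h11 : ∀ i j : Fin n, s 11 (((i : ℕ) : ℤ) * n + (j : ℕ)) = (X * P) i j)
    (hX : ∀ i j, (X i j).natAbs ≤ b) (hP : ∀ i j, (P i j).natAbs ≤ c)
    (hn : n ≤ N) (hN : n * (n * (b * c)) < 2 ^ N)
    (hQ : ∀ s' : RamMemory, (∀ x ∉ [12, 13, 15], s' x = s x) →
      s' 12 0 = (X * P).trace / (r + 1) → Q s') :
    progCoeff.WP N s Q := by
  refine .seq (.sum (fun m => (X * P) m m) (n * (b * c)) hn (by decide) (fun s2 h2 => ?_)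
    (fun m s2 h2 hm => ?_) (fun m => natAbs_mul_apply_le hX hP m m) hN (fun s2 h2 hs2 => ?_))
  · rw [RamExpr.eval_var, h2 0 (by decide) (by decide), h0]
  · simp only [RamExpr.eval_mul, RamExpr.eval_read, RamExpr.eval_add, RamExpr.eval_var, hm,
      h2 0 (by decide) (by decide), h0, h2 11 (by decide) (by decide), h11]
  · have hval : (RamExpr.div (.var 13) (.add (.var 18) (.const 1))).eval s2 =
        (X * P).trace / (r + 1) := by
      simp only [RamExpr.eval_div, RamExpr.eval_var, RamExpr.eval_add, RamExpr.eval_const, hs2,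
        h2 18 (by decide) (by decide), h18, Matrix.trace, Matrix.diag_apply]
    refine .assign ?_ fun s3 h3 hs3 => hQ s3 (fun x hx => ?_) (hs3.trans hval)
    · rw [hval]
      exact ((Int.natAbs_ediv_le_natAbs _ _).trans (natAbs_trace_mul_le hX hP)).trans_lt hN
    · simp only [List.mem_cons, List.not_mem_nil, not_or, or_false] at hx
      rw [h3 x (by tauto), h2 x (by tauto) (by tauto)]

theorem wp_progStep {X P : Matrix (Fin n) (Fin n) ℤ} {r : ℕ} {c : ℤ} (h0 : s 0 0 = n)
    (h18 : s 18 0 = r) (h12 : s 12 0 = c)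
    (h11 : ∀ i j : Fin n, s 11 (((i : ℕ) : ℤ) * n + (j : ℕ)) = (X * P) i j)
    (hn : n * n ≤ N) (hN : ∀ i j, ((c • 1 - X * P) i j).natAbs < 2 ^ N)
    (hQ : ∀ s' : RamMemory, (∀ x ∉ [10, 14], s' x = s x) →
      (∀ i j : Fin n, s' 10 (((r : ℤ) + 1) * (n * n : ℕ) + (((i : ℕ) : ℤ) * n + (j : ℕ))) =
        (c • 1 - X * P) i j) →
      (∀ y, y < ((r : ℤ) + 1) * (n * n : ℕ) → s' 10 y = s 10 y) → Q s') :
    progStep.WP N s Q := by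
  refine .fillMat (((r : ℤ) + 1) * (n * n : ℕ)) (fun i j => (c • 1 - X * P) i j) hn (by decide)
    (by decide) (by decide) (fun s' h => RamExpr.eval_dimSq ?_) (fun s' h => ?_) hN ?_ ?_
  · rw [h 0 (by decide) (by decide) (by decide), h0]
  · have h0' : s' 0 0 = n := by rw [h 0 (by decide) (by decide) (by decide), h0]
    simp only [RamExpr.eval_mul, RamExpr.eval_add, RamExpr.eval_var, RamExpr.eval_const,
      RamExpr.eval_dimSq h0', h 18 (by decide) (by decide) (by decide), h18]
  · intro i j s' h h14
    have h0' : s' 0 0 = n := by rw [h 0 (by decide) (by decide) (by decide), h0]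
    refine .skip ?_
    simp only [RamExpr.eval_sub, RamExpr.eval_mul, RamExpr.eval_var, RamExpr.eval_read,
      RamExpr.eval_delta (RamExpr.eval_row h0' h14) (RamExpr.eval_col h0' h14), h14,
      h 12 (by decide) (by decide) (by decide), h12, h 11 (by decide) (by decide) (by decide), h11,
      Matrix.sub_apply, Matrix.smul_apply, smul_eq_mul]
  · intro s' h h1 h2
    refine hQ s' (fun x hx => ?_) h1 h2
    simp only [List.mem_cons, List.not_mem_nil, not_or, or_false] at hx
    exact h x (by tauto) (by tauto) (by simp [RamProg.writes])

/-- All blocks are kept, since the kernel vector of a singular matrix may come from any of them. -/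
theorem wp_progFadLev {X : Matrix (Fin n) (Fin n) ℤ} {b G : ℕ} (h0 : s 0 0 = n)
    (h9 : ∀ i j : Fin n, s 9 (((i : ℕ) : ℤ) * n + (j : ℕ)) = X i j)
    (hX : ∀ i j, (X i j).natAbs ≤ b) (hG : n * n * b + n * b ≤ G) (hG1 : 1 ≤ G)
    (hn : n * n ≤ N) (hN : G ^ n < 2 ^ N)
    (hQ : ∀ s' : RamMemory, (∀ x ∉ [10, 11, 12, 13, 14, 15, 18], s' x = s x) →
      (∀ r ≤ n, ∀ i j : Fin n, s' 10 ((r : ℤ) * (n * n : ℕ) + (((i : ℕ) : ℤ) * n + (j : ℕ))) =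
        fadLevMat X r i j) →
      (0 < n → s' 12 0 = fadLevCoeff X (n - 1)) → Q s') :
    progFadLev.WP N s Q := by
  have hnN : n ≤ N := (Nat.le_mul_self n).trans hn
  have hP : ∀ r i j, (fadLevMat X r i j).natAbs ≤ G ^ r := natAbs_fadLevMat_le hX hG
  have hpow : ∀ r ≤ n, G ^ r < 2 ^ N := fun r hr => (Nat.pow_le_pow_right hG1 hr).trans_lt hN
  -- The intermediate trace and product bounds are the two summands of the bound for block `r + 1`.
  have hsmall : ∀ r < n, n * (n * (b * G ^ r)) < 2 ^ N ∧ n * (b * G ^ r) < 2 ^ N := by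
    intro r hr
    have h1 := hpow (r + 1) hr
    have h2 := Nat.mul_le_mul_right (G ^ r) hG
    rw [pow_succ'] at h1
    have h3 : (n * n * b + n * b) * G ^ r = n * (n * (b * G ^ r)) + n * (b * G ^ r) := by ring
    omega
  refine .seq (.fillMat 0 (fun i j => (1 : Matrix (Fin n) (Fin n) ℤ) i j) hn (by decide)
    (by decide) (by decide) (fun s' h => RamExpr.eval_dimSq ?_) (fun _ _ => rfl)
    (fun i j => (hP 0 i j).trans_lt (hpow 0 (Nat.zero_le _))) ?_ ?_)
  · rw [h 0 (by decide) (by decide) (by decide), h0]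
  · intro i j s' h h14
    have h0' : s' 0 0 = n := by rw [h 0 (by decide) (by decide) (by decide), h0]
    exact .skip (RamExpr.eval_delta (RamExpr.eval_row h0' h14) (RamExpr.eval_col h0' h14))
  · intro s1 h1 h10 _
    have hw : ∀ x, x ∉ (RamProg.seq progProd (.seq progCoeff progStep)).writes ↔
        x ∉ [10, 11, 12, 13, 14, 15] := by
      intro x
      simp [progProd, progCoeff, progStep, RamProg.fill, RamProg.sum, RamProg.forLoop,
        RamProg.assign, RamProg.writes]
      tauto
    refine .forLoop (fun r s' => (∀ q ≤ r, ∀ i j : Fin n,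
      s' 10 ((q : ℤ) * (n * n : ℕ) + (((i : ℕ) : ℤ) * n + (j : ℕ))) = fadLevMat X q i j) ∧
      (0 < r → s' 12 0 = fadLevCoeff X (r - 1))) n hnN ((hw _).2 (by decide)) ?_ ?_ ?_ ?_ ?_
    · intro r s' s'' h hI
      rw [h 10 (by decide), h 12 (by decide)]
      exact hI
    · intro s' h
      rw [RamExpr.eval_var, h 0 (by decide) ((hw _).2 (by decide)),
        h1 0 (by decide) (by decide) (by decide), h0]
    · refine ⟨fun q hq i j => ?_, fun h => absurd h (lt_irrefl _)⟩
      obtain rfl : q = 0 := by omega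
      simpa [fadLevMat] using h10 i j
    · rintro r hr s' h h18 ⟨hblock, -⟩
      have h0' : s' 0 0 = n := by
        rw [h 0 (by decide) ((hw _).2 (by decide)), h1 0 (by decide) (by decide) (by decide), h0]
      have h9' : ∀ i j : Fin n, s' 9 (((i : ℕ) : ℤ) * n + (j : ℕ)) = X i j := by
        intro i j
        rw [h 9 (by decide) ((hw _).2 (by decide)), h1 9 (by decide) (by decide) (by decide), h9]
      refine .seq (wp_progProd h0' h18 h9' (hblock r le_rfl) hX (hP r) hn (hsmall r hr).2
        fun s2 h2 h2v => ?_)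
      refine .seq (wp_progCoeff (by rw [h2 0 (by decide), h0']) (by rw [h2 18 (by decide), h18])
        h2v hX (hP r) hnN (hsmall r hr).1 fun s3 h3 h3v => ?_)
      refine wp_progStep (X := X) (P := fadLevMat X r) (r := r) (c := fadLevCoeff X r)
        (by rw [h3 0 (by decide), h2 0 (by decide), h0'])
        (by rw [h3 18 (by decide), h2 18 (by decide), h18]) h3v
        (fun i j => by rw [h3 11 (by decide), h2v]) hn
        (fun i j => (hP (r + 1) i j).trans_lt (hpow _ hr)) fun s4 h4 h4v h4o => ?_
      refine ⟨fun q hq i j => ?_, fun _ => ?_⟩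
      · rcases Nat.lt_or_eq_of_le hq with hq | rfl
        · rw [h4o, h3 10 (by decide), h2 10 (by decide)]
          · exact hblock q (by omega) i j
          -- Block `q` ends before cell `(r + 1) * n * n`, where writing starts.
          · have hij : (i : ℕ) * n + j < n * n := by
              calc (i : ℕ) * n + j < i * n + n := by omega
                _ = (i + 1) * n := by ring
                _ ≤ n * n := Nat.mul_le_mul_right _ i.2
            have hqr : q * (n * n) ≤ r * (n * n) := Nat.mul_le_mul_right _ (by omega)
            rw [add_mul, one_mul]
            exact_mod_cast (by omega : q * (n * n) + (i * n + j) < r * (n * n) + n * n)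
        · push_cast
          exact_mod_cast h4v i j
      · rw [h4 12 (by decide), h3v]
        rfl
    · rintro s' h ⟨hI1, hI2⟩
      refine hQ s' (fun x hx => ?_) hI1 hI2
      simp only [List.mem_cons, List.not_mem_nil, not_or, or_false] at hx
      rw [h x (by tauto) ((hw x).2 (by simp; tauto)),
        h1 x (by tauto) (by tauto) (by simp [RamProg.writes])]

end FaddeevLeVerrierProgram

/-! ### Clearing denominators -/

section ClearDenominators

variable {n : ℕ}

/-- The product of all denominators of `M`. -/
def commonDen (M : Matrix (Fin n) (Fin n) ℚ) : ℕ :=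
  ∏ t : Fin (n * n), (M t.divNat t.modNat).den

/-- The integer matrix `commonDen M • M`. -/
def clearDen (M : Matrix (Fin n) (Fin n) ℚ) : Matrix (Fin n) (Fin n) ℤ :=
  fun i j => (M i j).num * ((commonDen M : ℤ) / ((M i j).den : ℤ))

theorem commonDen_pos (M : Matrix (Fin n) (Fin n) ℚ) : 0 < commonDen M :=
  Finset.prod_pos fun _ _ => Rat.den_pos _

theorem den_dvd_commonDen (M : Matrix (Fin n) (Fin n) ℚ) (i j : Fin n) :
    (M i j).den ∣ commonDen M := by
  have h5 := finProdFinEquiv.symm_apply_apply (i, j)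
  simp only [finProdFinEquiv_symm_apply, Prod.mk.injEq] at h5
  have := Finset.dvd_prod_of_mem (fun t : Fin (n * n) => (M t.divNat t.modNat).den)
    (Finset.mem_univ (finProdFinEquiv (i, j)))
  rwa [h5.1, h5.2] at this

theorem clearDen_cast (M : Matrix (Fin n) (Fin n) ℚ) (i j : Fin n) :
    (clearDen M i j : ℚ) = (commonDen M : ℚ) * M i j := by
  obtain ⟨d, hd⟩ := den_dvd_commonDen M i j
  have hden : ((M i j).den : ℤ) ≠ 0 := by exact_mod_cast (M i j).den_ne_zero
  have h1 : clearDen M i j = (M i j).num * d := by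
    rw [clearDen, hd, Nat.cast_mul, Int.mul_ediv_cancel_left _ hden]
  rw [h1, hd]
  have h2 := Rat.mul_den_eq_num (M i j)
  push_cast
  rw [← h2]
  ring

theorem sum_bitLen_le_bitSize (M : Matrix (Fin n) (Fin n) ℚ) (i j : Fin n) :
    bitLen (M i j).num + bitLen (M i j).den ≤ bitSize M :=
  (Finset.single_le_sum (f := fun j => bitLen (M i j).num + bitLen (M i j).den)
    (fun _ _ => Nat.zero_le _) (Finset.mem_univ j)).trans
    (Finset.single_le_sum (f := fun i => ∑ j, (bitLen (M i j).num + bitLen (M i j).den))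
    (fun _ _ => Nat.zero_le _) (Finset.mem_univ i))

theorem natAbs_lt_two_pow_bitLen (z : ℤ) : z.natAbs < 2 ^ bitLen z :=
  (Nat.lt_size_self _).trans_le (Nat.pow_le_pow_right (by norm_num) (Nat.le_succ _))

theorem natAbs_num_lt (M : Matrix (Fin n) (Fin n) ℚ) (i j : Fin n) :
    (M i j).num.natAbs < 2 ^ bitSize M :=
  (natAbs_lt_two_pow_bitLen _).trans_le (Nat.pow_le_pow_right (by norm_num)
    ((Nat.le_add_right _ _).trans (sum_bitLen_le_bitSize M i j)))

theorem den_lt (M : Matrix (Fin n) (Fin n) ℚ) (i j : Fin n) :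
    (M i j).den < 2 ^ bitSize M :=
  (natAbs_lt_two_pow_bitLen ((M i j).den : ℤ)).trans_le (Nat.pow_le_pow_right (by norm_num)
    ((Nat.le_add_left _ _).trans (sum_bitLen_le_bitSize M i j)))

/-- The bit length of a product is at most the sum of the bit lengths, so the product serves as well
as a least common multiple. -/
theorem commonDen_le (M : Matrix (Fin n) (Fin n) ℚ) : commonDen M ≤ 2 ^ bitSize M := by
  have h1 : commonDen M = ∏ i, ∏ j, (M i j).den := by
    rw [commonDen, ← Fintype.prod_prod_type' (f := fun i j => (M i j).den)]
    exact Fintype.prod_equiv finProdFinEquiv.symm _ _ fun t => rfl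
  rw [h1, bitSize, ← Finset.prod_pow_eq_pow_sum]
  refine Finset.prod_le_prod' fun i _ => ?_
  rw [← Finset.prod_pow_eq_pow_sum]
  refine Finset.prod_le_prod' fun j _ => ?_
  exact (natAbs_lt_two_pow_bitLen ((M i j).den : ℤ)).le.trans
    (Nat.pow_le_pow_right (by norm_num) (Nat.le_add_left _ _))

theorem natAbs_clearDen_le (M : Matrix (Fin n) (Fin n) ℚ) (i j : Fin n) :
    (clearDen M i j).natAbs ≤ 2 ^ (2 * bitSize M) := by
  rw [clearDen, Int.natAbs_mul, two_mul, pow_add]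
  exact Nat.mul_le_mul (natAbs_num_lt M i j).le
    ((Int.natAbs_ediv_le_natAbs _ _).trans (commonDen_le M))

/-- Array `7` becomes the integer matrix `clearDen M`. -/
def progClearDen : RamProg :=
  .seq (.assign 6 (.const 1))
    (.seq (.forLoop 14 .dimSq (.assign 6 (.mul (.var 6) (.read 3 (.var 14)))))
      (.fill 14 7 .dimSq (.const 0) .skip
        (.mul (.read 2 (.var 14)) (.div (.var 6) (.read 3 (.var 14))))))

variable {N : ℕ} {s : RamMemory} {Q : RamMemory → Prop}

theorem wp_progClearDen {M : Matrix (Fin n) (Fin n) ℚ} (h0 : s 0 0 = n)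
    (h2 : ∀ i j : Fin n, s 2 (((i : ℕ) : ℤ) * n + (j : ℕ)) = (M i j).num)
    (h3 : ∀ i j : Fin n, s 3 (((i : ℕ) : ℤ) * n + (j : ℕ)) = ((M i j).den : ℤ))
    (hn : n * n ≤ N) (hN : 2 ^ (2 * bitSize M) < 2 ^ N)
    (hQ : ∀ s' : RamMemory, (∀ x ∉ [6, 7, 14], s' x = s x) →
      (∀ i j : Fin n, s' 7 (((i : ℕ) : ℤ) * n + (j : ℕ)) = clearDen M i j) → Q s') :
    progClearDen.WP N s Q := by
  have h1N : 1 < 2 ^ N := Nat.one_le_two_pow.trans_lt hN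
  have hDN : commonDen M < 2 ^ N := (commonDen_le M).trans_lt
    ((Nat.pow_le_pow_right (by norm_num) (by omega)).trans_lt hN)
  set g : ℕ → ℕ := fun t => if h : t < n * n then
    (M (Fin.divNat ⟨t, h⟩) (Fin.modNat ⟨t, h⟩)).den else 1 with hg
  have hgpos : ∀ t, 1 ≤ g t := by
    intro t
    simp only [hg]
    split_ifs
    · exact Rat.den_pos _
    · exact le_rfl
  have hD : commonDen M = ∏ t ∈ Finset.range (n * n), g t := by
    rw [Finset.prod_range]
    simp [hg, commonDen]
  -- All factors are at least `1`, so no partial product exceeds the full one.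
  have hpart : ∀ i ≤ n * n, ∏ t ∈ Finset.range i, g t < 2 ^ N := by
    intro i hi
    refine lt_of_le_of_lt ?_ hDN
    rw [hD]
    exact Finset.prod_le_prod_of_subset_of_one_le' (Finset.range_mono hi) fun t _ _ => hgpos t
  have hw : ∀ x, x ∉ (RamProg.assign 6 (.mul (.var 6) (.read 3 (.var 14)))).writes ↔ x ≠ 6 := by
    intro x
    simp [RamProg.assign, RamProg.writes]
  refine .seq (.assign (by simpa using h1N) fun s1 hs1 hs1v => .seq ?_)
  refine .forLoop (fun i s' => s' 6 0 = ((∏ t ∈ Finset.range i, g t : ℕ) : ℤ)) (n * n) hn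
    (by decide) ?_ ?_ ?_ ?_ ?_
  · intro i s' s'' h hI
    rw [h 6 (by decide), hI]
  · intro s' h
    exact RamExpr.eval_dimSq (by rw [h 0 (by decide) (by decide), hs1 0 (by decide), h0])
  · simpa using hs1v
  · intro i hi s' h h14 hI
    have h33 : s' 3 = s 3 := by rw [h 3 (by decide) (by decide), hs1 3 (by decide)]
    have hread : s 3 (i : ℤ) = (g i : ℤ) := by
      have h4 := h3 (Fin.divNat ⟨i, hi⟩) (Fin.modNat ⟨i, hi⟩)
      have h5 := Nat.div_add_mod' i n
      simp only [Fin.coe_divNat, Fin.coe_modNat] at h4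
      have h6 : ((i / n : ℕ) : ℤ) * n + ((i % n : ℕ) : ℤ) = i := by exact_mod_cast h5
      rw [h6] at h4
      simp only [h4, hg, dif_pos hi]
    have hval : (RamExpr.mul (.var 6) (.read 3 (.var 14))).eval s' =
        ((∏ t ∈ Finset.range (i + 1), g t : ℕ) : ℤ) := by
      rw [RamExpr.eval_mul, RamExpr.eval_var, RamExpr.eval_read, RamExpr.eval_var, h14, h33, hI,
        hread, Finset.prod_range_succ, Nat.cast_mul]
    refine .assign ?_ fun s2 _ h => h.trans hval
    rw [hval, Int.natAbs_natCast]
    exact hpart _ hi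
  · intro s2 hs2 h6
    rw [← hD] at h6
    have hfr : ∀ x, x ≠ 6 → x ≠ 14 → s2 x = s x := fun x hx hx' => by
      rw [hs2 x hx' ((hw x).2 hx), hs1 x hx]
    refine .fillMat 0 (fun i j => clearDen M i j) hn (by decide) (by decide) (by decide)
      (fun s' h => RamExpr.eval_dimSq ?_) (fun _ _ => rfl)
      (fun i j => (natAbs_clearDen_le M i j).trans_lt hN) ?_ ?_
    · rw [h 0 (by decide) (by decide) (by decide), hfr 0 (by decide) (by decide), h0]
    · intro i j s' h h14
      refine .skip ?_
      simp only [RamExpr.eval_mul, RamExpr.eval_read, RamExpr.eval_div, RamExpr.eval_var, h14,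
        h 2 (by decide) (by decide) (by decide), h 3 (by decide) (by decide) (by decide),
        h 6 (by decide) (by decide) (by decide), h6, hfr 2 (by decide) (by decide),
        hfr 3 (by decide) (by decide), h2, h3]
      rfl
    · intro s' h h1 _
      refine hQ s' (fun x hx => ?_) (by simpa using h1)
      simp only [List.mem_cons, List.not_mem_nil, not_or, or_false] at hx
      rw [h x (by tauto) (by tauto) (by simp [RamProg.writes]), hfr x (by tauto) (by tauto)]

end ClearDenominators

/-! ### The conversion program -/

section ConversionProgram

variable {n : ℕ}

/-- Row `j` of the matrix in array `9` is masked, where `j` is the value of variable `8`. -/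
def progRow : RamProg :=
  .fill 14 9 (.var 0) (.mul (.var 8) (.var 0)) .skip
    (.add (.delta (.var 8) (.var 14)) (.mul (.read 1 (.var 8))
      (.sub (.read 7 (.add (.mul (.var 8) (.var 0)) (.var 14))) (.delta (.var 8) (.var 14)))))

/-- The column of array `10` that starts at the value of `o` is copied to the output. -/
def progOut (o : RamExpr) : RamProg :=
  .fill 14 4 (.var 0) (.const 0) .skip (.read 10 (.add o (.mul (.var 14) (.var 0))))

/-- Variable `17` becomes the number of the last non-zero cell of array `10`. -/
def progSearch : RamProg :=
  .seq (.assign 17 (.const 0)) (.forLoop 14 (.mul (.var 0) .dimSq)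
    (.branch (.mul (.read 10 (.var 14)) (.read 10 (.var 14))) (.assign 17 (.var 14)) .skip))

/-- Round of the search for the first non-positive minor. -/
def progRound : RamProg :=
  .seq progRow (.seq progFadLev (.branch (.var 16) .skip (.branch (.var 12) .skip
    (.seq (progOut (.add (.mul (.sub (.var 0) (.const 1)) .dimSq) (.var 8)))
      (.assign 16 (.const 1))))))

/-- The conversion of a non-positive minor to a sign-reversing vector. -/
def progConvert : RamProg :=
  .seq progClearDen
  (.seq (.fill 14 9 .dimSq (.const 0) .skip (.delta (.row 14) (.col 14)))
  (.seq (.forLoop 8 (.var 0) progRound)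
  (.seq (.branch (.sub (.const 0) (.var 12)) .skip
    (.seq progSearch (progOut (.add (.mul (.div (.var 17) .dimSq) .dimSq) (.col 17)))))
  (.fill 14 5 (.var 0) (.const 0) .skip (.const 1)))))

variable {N : ℕ} {s : RamMemory} {Q : RamMemory → Prop}

theorem natAbs_rowMask_le {A : Matrix (Fin n) (Fin n) ℤ} (α : Finset (Fin n)) (k : ℕ) {b : ℕ}
    (hA : ∀ i j, (A i j).natAbs ≤ b) (hb : 1 ≤ b) (i j : Fin n) :
    (rowMask A α k i j).natAbs ≤ b := by
  rw [rowMask, Matrix.one_apply]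
  split_ifs
  · exact hA i j
  · simpa using hb
  · simp

/-- Consecutive masks differ at most in row `j`, so the update is done in place. The expression `δ +
[j ∈ α] * (A - δ)` selects the row without branching. -/
theorem wp_progRow {A : Matrix (Fin n) (Fin n) ℤ} {α : Finset (Fin n)} {b : ℕ} {j : Fin n}
    (h0 : s 0 0 = n) (h8 : s 8 0 = (j : ℕ))
    (h1 : ∀ i : Fin n, s 1 (i : ℕ) = if i ∈ α then 1 else 0)
    (h7 : ∀ i m : Fin n, s 7 (((i : ℕ) : ℤ) * n + (m : ℕ)) = A i m)
    (h9 : ∀ i m : Fin n, s 9 (((i : ℕ) : ℤ) * n + (m : ℕ)) = rowMask A α j i m)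
    (hA : ∀ i m, (A i m).natAbs ≤ b) (hb : 1 ≤ b) (hn : n ≤ N) (hN : b < 2 ^ N)
    (hQ : ∀ s' : RamMemory, (∀ x ∉ [9, 14], s' x = s x) →
      (∀ i m : Fin n, s' 9 (((i : ℕ) : ℤ) * n + (m : ℕ)) = rowMask A α (j + 1) i m) → Q s') :
    progRow.WP N s Q := by
  refine .fill (((j : ℕ) : ℤ) * n) (fun m => rowMask A α (j + 1) j m) hn (by decide) (by decide)
    (by decide) (fun s' h => ?_) (fun s' h => ?_)
    (fun m => (natAbs_rowMask_le α _ hA hb _ _).trans_lt hN) (fun m s' h h14 => ?_)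
    (fun s' h hin hout => hQ s' (fun x hx => ?_) fun i m => ?_)
  · rw [RamExpr.eval_var, h 0 (by decide) (by decide) (by decide), h0]
  · rw [RamExpr.eval_mul, RamExpr.eval_var, RamExpr.eval_var,
      h 0 (by decide) (by decide) (by decide), h 8 (by decide) (by decide) (by decide), h0, h8]
  · refine .skip ?_
    have h8' : (RamExpr.var 8).eval s' = (j : ℕ) := by
      rw [RamExpr.eval_var, h 8 (by decide) (by decide) (by decide), h8]
    have h14' : (RamExpr.var 14).eval s' = (m : ℕ) := h14
    have hlt : (j : ℕ) < j + 1 := Nat.lt_succ_self _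
    simp only [RamExpr.eval_add, RamExpr.eval_mul, RamExpr.eval_sub, RamExpr.eval_read,
      RamExpr.eval_delta h8' h14', h8', h14']
    rw [RamExpr.eval_var, h 0 (by decide) (by decide) (by decide), h0,
      h 1 (by decide) (by decide) (by decide), h 7 (by decide) (by decide) (by decide), h1, h7,
      rowMask]
    by_cases hj : j ∈ α <;> simp [hj]
  · simp only [List.mem_cons, List.not_mem_nil, not_or, or_false] at hx
    exact h x (by tauto) (by tauto) (by simp [RamProg.writes])
  · rcases lt_trichotomy (i : ℕ) j with hij | hij | hij
    · have hle : ((i : ℕ) + 1) * n ≤ j * n := Nat.mul_le_mul_right _ hij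
      rw [add_mul] at hle
      rw [hout _ (.inl _), h9, rowMask, rowMask]
      · have : (i : ℕ) < j + 1 := by omega
        simp only [hij, this]
      · exact_mod_cast (by omega : (i : ℕ) * n + m < j * n)
    · obtain rfl := Fin.ext hij
      exact hin m
    · have hle : ((j : ℕ) + 1) * n ≤ i * n := Nat.mul_le_mul_right _ hij
      rw [add_mul] at hle
      rw [hout _ (.inr _), h9, rowMask, rowMask]
      · have h2 : ¬ (i : ℕ) < j + 1 := by omega
        have h3 : ¬ (i : ℕ) < j := by omega
        simp only [h2, h3]
      · exact_mod_cast (by omega : (j : ℕ) * n + n ≤ i * n + m)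

theorem wp_progOut {o : RamExpr} {z : ℤ} {x : Fin n → ℤ} (h0 : s 0 0 = n)
    (ho : ∀ s' : RamMemory, (∀ y ∉ [4, 14], s' y = s y) → o.eval s' = z)
    (hx : ∀ i : Fin n, s 10 (z + ((i : ℕ) : ℤ) * n) = x i)
    (hn : n ≤ N)
    (hQ : ∀ s' : RamMemory, (∀ y ∉ [4, 14], s' y = s y) →
      (∀ i : Fin n, s' 4 (i : ℕ) = x i) → Q s') :
    (progOut o).WP N s Q := by
  have hfr : ∀ s' : RamMemory, (∀ y, y ≠ 14 → y ≠ 4 → y ∉ RamProg.skip.writes → s' y = s y) →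
      ∀ y ∉ [4, 14], s' y = s y := by
    intro s' h y hy
    simp only [List.mem_cons, List.not_mem_nil, not_or, or_false] at hy
    exact h y (by tauto) (by tauto) (by simp [RamProg.writes])
  -- Copied values fit because the cells they come from already do.
  refine .of_bdd fun hs => .fill 0 x hn (by decide) (by decide) (by decide) (fun s' h => ?_)
    (fun _ _ => rfl) (fun i => by rw [← hx]; exact hs _ _) (fun i s' h h14 => .skip ?_)
    (fun s' h hin _ => hQ s' (hfr s' h) (by simpa using hin))
  · rw [RamExpr.eval_var, h 0 (by decide) (by decide) (by decide), h0]
  · rw [RamExpr.eval_read, RamExpr.eval_add, RamExpr.eval_mul, ho s' (hfr s' h), RamExpr.eval_var,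
      RamExpr.eval_var, h14, h 0 (by decide) (by decide) (by decide), h0,
      h 10 (by decide) (by decide) (by decide), hx]

theorem wp_progSearch (h0 : s 0 0 = n) (h10 : s 10 0 ≠ 0) (hpos : 0 < n) (hn : n * (n * n) ≤ N)
    (hQ : ∀ s' : RamMemory, (∀ y ∉ [14, 17], s' y = s y) →
      ∀ l < n * (n * n), s' 17 0 = (l : ℕ) → s 10 l ≠ 0 →
      (∀ u, l < u → u < n * (n * n) → s 10 u = 0) → Q s') :
    progSearch.WP N s Q := by
  refine .seq (.assign (by simp) fun s1 hs1 hs1v => ?_)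
  refine .forLoop (fun i s' => ∃ l < n * (n * n), s' 17 0 = (l : ℕ) ∧ s 10 l ≠ 0 ∧
    ∀ u, l < u → u < i → s 10 u = 0) (n * (n * n)) hn (by decide) ?_ ?_ ?_ ?_ ?_
  · intro i s' s'' h hI
    rwa [h 17 (by decide)]
  · intro s' h
    have : s' 0 0 = n := by rw [h 0 (by decide) (by decide), hs1 0 (by decide), h0]
    rw [RamExpr.eval_mul, RamExpr.eval_var, RamExpr.eval_dimSq this, this]
    push_cast
    rfl
  -- The initial guess `0` is legitimate because cell `0` is assumed non-zero; in the application it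
  -- holds an entry of `P_0 = 1`.
  · exact ⟨0, by positivity, by simpa using hs1v, by simpa using h10, fun u _ h => by omega⟩
  · rintro i hi s' h h14 ⟨l, hl, hl17, hl10, hu⟩
    have h10' : s' 10 = s 10 := by rw [h 10 (by decide) (by decide), hs1 10 (by decide)]
    have hval : (RamExpr.mul (.read 10 (.var 14)) (.read 10 (.var 14))).eval s' =
        s 10 i * s 10 i := by
      rw [RamExpr.eval_mul, RamExpr.eval_read, RamExpr.eval_var, h14, h10']
    refine .branch (fun he => .assign ?_ fun s2 _ h2 => ⟨i, hi, ?_, ?_, fun u h1 h2 => by omega⟩)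
      (fun he => .skip ⟨l, hl, hl17, hl10, fun u h1 h2 => ?_⟩)
    · rw [RamExpr.eval_var, h14, Int.natAbs_natCast]
      exact (hi.trans_le hn).trans Nat.lt_two_pow_self
    · rw [h2, RamExpr.eval_var, h14]
    · intro hz
      rw [hval, hz] at he
      simp at he
    · rcases Nat.lt_succ_iff_lt_or_eq.1 h2 with h2 | rfl
      · exact hu u h1 h2
      · rw [hval] at he
        by_contra hz
        exact he (mul_self_pos.2 hz)
  · rintro s' h ⟨l, hl, hl17, hl10, hu⟩
    refine hQ s' (fun y hy => ?_) l hl hl17 hl10 hu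
    simp only [List.mem_cons, List.not_mem_nil, not_or, or_false] at hy
    rw [h y (by tauto) (by simp [RamProg.writes, RamProg.assign]; tauto), hs1 y (by tauto)]

end ConversionProgram

section ConversionProgramCorrectness

variable {n N : ℕ} {s : RamMemory} {Q : RamMemory → Prop}

/-- Invariant of the search for the first non-positive minor: array `9` holds the masked matrix,
array `10` and variable `12` the result of the recursion of the last round, and variable `16` tells
whether a column of an adjugate has been written to array `4`. -/
structure RoundInv (A : Matrix (Fin n) (Fin n) ℤ) (α : Finset (Fin n)) (k : ℕ) (s : RamMemory) :
    Prop where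
  mat : ∀ i j : Fin n, s 9 (((i : ℕ) : ℤ) * n + (j : ℕ)) = rowMask A α k i j
  block : 0 < k → ∀ r ≤ n, ∀ i j : Fin n,
    s 10 ((r : ℤ) * (n * n : ℕ) + (((i : ℕ) : ℤ) * n + (j : ℕ))) = fadLevMat (rowMask A α k) r i j
  det : 0 < k → s 12 0 = (rowMask A α k).det
  out : (s 16 0 = 0 ∧ ∀ q ≤ k, 0 < (rowMask A α q).det) ∨
    (s 16 0 = 1 ∧ ∃ j : Fin n, 0 < (rowMask A α j).det ∧ (rowMask A α (j + 1)).det ≤ 0 ∧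
      ∀ i : Fin n, s 4 (i : ℕ) = (rowMask A α (j + 1)).adjugate i j)

theorem RoundInv.congr {A : Matrix (Fin n) (Fin n) ℤ} {α : Finset (Fin n)} {k : ℕ}
    {s s' : RamMemory} (h : RoundInv A α k s) (hs : ∀ x, x ≠ 8 → s' x = s x) :
    RoundInv A α k s' := by
  refine ⟨?_, ?_, ?_, ?_⟩
  · rw [hs 9 (by decide)]
    exact h.mat
  · rw [hs 10 (by decide)]
    exact h.block
  · rw [hs 12 (by decide)]
    exact h.det
  · rw [hs 16 (by decide), hs 4 (by decide)]
    exact h.out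

/-- The rounds go on after a column has been output, because the final decision needs the
determinant and the blocks of the full mask. The flag in variable `16` protects the first hit. -/
theorem wp_progRound {A : Matrix (Fin n) (Fin n) ℤ} {α : Finset (Fin n)} {b G : ℕ} {j : Fin n}
    (h0 : s 0 0 = n) (h8 : s 8 0 = (j : ℕ))
    (h1 : ∀ i : Fin n, s 1 (i : ℕ) = if i ∈ α then 1 else 0)
    (h7 : ∀ i m : Fin n, s 7 (((i : ℕ) : ℤ) * n + (m : ℕ)) = A i m)
    (hA : ∀ i m, (A i m).natAbs ≤ b) (hb : 1 ≤ b) (hbN : b < 2 ^ N)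
    (hG : n * n * b + n * b ≤ G) (hG1 : 1 ≤ G) (hn : n * n ≤ N) (hN : G ^ n < 2 ^ N)
    (hI : RoundInv A α j s) : progRound.WP N s (RoundInv A α (j + 1)) := by
  have hnN : n ≤ N := (Nat.le_mul_self n).trans hn
  have hpos : 0 < n := j.pos
  refine .seq (wp_progRow h0 h8 h1 h7 hI.mat hA hb hnN hbN fun s2 h2 h2v => .seq ?_)
  refine wp_progFadLev (by rw [h2 0 (by decide), h0]) h2v (natAbs_rowMask_le α _ hA hb) hG hG1 hn hN
    fun s3 h3 h3b h3c => ?_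
  have h12 : s3 12 0 = (rowMask A α (j + 1)).det := by rw [h3c hpos, fadLevCoeff_last _ hpos]
  have h9 : s3 9 = s2 9 := h3 9 (by decide)
  have h16 : s3 16 0 = s 16 0 := by rw [h3 16 (by decide), h2 16 (by decide)]
  have h4 : s3 4 = s 4 := by rw [h3 4 (by decide), h2 4 (by decide)]
  have hmat : ∀ i m : Fin n, s3 9 (((i : ℕ) : ℤ) * n + (m : ℕ)) = rowMask A α (j + 1) i m := by
    rwa [h9]
  refine .branch (fun he => .skip ⟨hmat, fun _ => h3b, fun _ => h12, ?_⟩)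
    (fun he => .branch (fun hd => .skip ⟨hmat, fun _ => h3b, fun _ => h12, ?_⟩) (fun hd => .seq ?_))
  · rw [h16, h4]
    refine .inr (hI.out.resolve_left fun h => ?_)
    rw [RamExpr.eval_var, h16, h.1] at he
    exact lt_irrefl _ he
  · rw [RamExpr.eval_var, h16] at he
    rcases hI.out with h | h
    · refine .inl ⟨by rw [h16, h.1], fun q hq => ?_⟩
      rcases Nat.lt_succ_iff_lt_or_eq.1 (Nat.lt_succ_of_le hq) with hq | rfl
      · exact h.2 q (Nat.lt_succ_iff.1 hq)
      · rwa [RamExpr.eval_var, h12] at hd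
    · rw [h.1] at he
      exact absurd zero_lt_one he
  · rw [RamExpr.eval_var, h16] at he
    have hdets : ∀ q ≤ (j : ℕ), 0 < (rowMask A α q).det := by
      rcases hI.out with h | h
      · exact h.2
      · rw [h.1] at he
        exact absurd zero_lt_one he
    have h03 : s3 0 0 = n := by rw [h3 0 (by decide), h2 0 (by decide), h0]
    have h83 : s3 8 0 = (j : ℕ) := by rw [h3 8 (by decide), h2 8 (by decide), h8]
    refine wp_progOut (z := ((n - 1 : ℕ) : ℤ) * (n * n : ℕ) + (j : ℕ))
      (x := fun i => (rowMask A α (j + 1)).adjugate i j) h03 (fun s' h => ?_) (fun i => ?_) hnN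
      fun s4 h4 h4v => .assign ?_ fun s5 h5 h5v => ?_
    · have h0' : s' 0 0 = n := by rw [h 0 (by decide), h03]
      rw [RamExpr.eval_add, RamExpr.eval_mul, RamExpr.eval_dimSq h0', RamExpr.eval_sub,
        RamExpr.eval_var, RamExpr.eval_var, h0', h 8 (by decide), h83, RamExpr.eval_const,
        Nat.cast_sub hpos, Nat.cast_one]
    · rw [← fadLevMat_last _ hpos, ← h3b (n - 1) (Nat.sub_le _ _)]
      congr 1
      ring
    · simpa using lt_of_le_of_lt hb hbN
    · refine ⟨?_, fun _ => ?_, fun _ => ?_, .inr ⟨h5v, j, hdets j le_rfl, ?_, ?_⟩⟩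
      · rwa [h5 9 (by decide), h4 9 (by decide)]
      · rwa [h5 10 (by decide), h4 10 (by decide)]
      · rw [h5 12 (by decide), h4 12 (by decide), h12]
      · rw [RamExpr.eval_var, h12] at hd
        exact not_lt.1 hd
      · rw [h5 4 (by decide)]
        exact h4v

/-- The last non-zero cell lies in the last non-zero block, and its column there is a non-zero
kernel vector. -/
theorem wp_kernelOut {X : Matrix (Fin n) (Fin n) ℤ} (h0 : s 0 0 = n) (hpos : 0 < n)
    (hX : X.det = 0)
    (h10 : ∀ r ≤ n, ∀ i j : Fin n,
      s 10 ((r : ℤ) * (n * n : ℕ) + (((i : ℕ) : ℤ) * n + (j : ℕ))) = fadLevMat X r i j)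
    (hn : n * (n * n) ≤ N)
    (hQ : ∀ s' : RamMemory, (∀ y ∉ [4, 14, 17], s' y = s y) → ∀ x : Fin n → ℤ, x ≠ 0 →
      X *ᵥ x = 0 → (∀ i : Fin n, s' 4 (i : ℕ) = x i) → Q s') :
    (RamProg.seq progSearch (progOut (.add (.mul (.div (.var 17) .dimSq) .dimSq) (.col 17)))).WP
      N s Q := by
  have hnn : 0 < n * n := Nat.mul_pos hpos hpos
  have hnN : n ≤ N := (Nat.le_mul_of_pos_right n hnn).trans hn
  refine .seq (wp_progSearch h0 ?_ hpos hn fun s2 h2 l hl hl17 hl10 hu => ?_)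
  · have := h10 0 (Nat.zero_le _) ⟨0, hpos⟩ ⟨0, hpos⟩
    simp only [Nat.cast_zero, zero_mul, add_zero] at this
    simp [this, fadLevMat]
  · set r := l / (n * n) with hr
    have hrn : r < n := Nat.div_lt_of_lt_mul (by rwa [mul_comm])
    have hlr : r * (n * n) + l % (n * n) = l := Nat.div_add_mod' l (n * n)
    have hlm : l % (n * n) < n * n := Nat.mod_lt _ hnn
    set i : Fin n := ⟨l % (n * n) / n, Nat.div_lt_of_lt_mul hlm⟩ with hi
    set j : Fin n := ⟨l % (n * n) % n, Nat.mod_lt _ hpos⟩ with hj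
    have hij : (i : ℕ) * n + j = l % (n * n) := Nat.div_add_mod' _ n
    have hlZ : (l : ℤ) = (r : ℤ) * (n * n : ℕ) + (((i : ℕ) : ℤ) * n + (j : ℕ)) := by
      rw [← hij] at hlr
      exact_mod_cast hlr.symm
    have hPl : fadLevMat X r i j ≠ 0 := by
      rw [← h10 r hrn.le i j, ← hlZ]
      exact hl10
    -- The search covers blocks `0` to `n - 1`. Block `r + 1` either lies in that range beyond `l`,
    -- or is block `n`, which vanishes.
    have hPz : fadLevMat X (r + 1) = 0 := by
      rcases Nat.lt_or_eq_of_le (Nat.succ_le_of_lt hrn) with hlt | heq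
      · ext i' j'
        rw [← h10 (r + 1) hlt.le i' j']
        have hij' : (i' : ℕ) * n + j' < n * n := by
          calc (i' : ℕ) * n + j' < i' * n + n := by omega
            _ = (i' + 1) * n := by ring
            _ ≤ n * n := Nat.mul_le_mul_right _ i'.2
        have h3 : (r + 1 + 1) * (n * n) ≤ n * (n * n) := Nat.mul_le_mul_right _ hlt
        have h4 := hu ((r + 1) * (n * n) + (i' * n + j')) (by rw [add_mul]; omega)
          (by rw [add_mul (r + 1)] at h3; omega)
        push_cast at h4 ⊢
        exact h4
      · rw [show r + 1 = n from heq]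
        exact fadLevMat_self X hpos
    have hXP := mul_fadLevMat_eq_zero X hX hrn hPz
    have h02 : s2 0 0 = n := by rw [h2 0 (by decide), h0]
    refine wp_progOut (z := (r : ℤ) * (n * n : ℕ) + (j : ℕ)) (x := fun i => fadLevMat X r i j) h02
      (fun s' h => ?_) (fun i' => ?_) hnN
      fun s3 h3 h3v => hQ s3 (fun y hy => ?_) (fun i => fadLevMat X r i j)
        (fun h => hPl (congrFun h i)) ?_ h3v
    · have h0' : s' 0 0 = n := by rw [h 0 (by decide), h02]
      have h17 : s' 17 0 = l := by rw [h 17 (by decide), hl17]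
      have hcol : (RamExpr.col 17).eval s' = (j : ℕ) :=
        RamExpr.eval_col (i := (r : ℤ) * n + (i : ℕ)) h0' (by rw [h17, hlZ]; push_cast; ring)
      rw [RamExpr.eval_add, RamExpr.eval_mul, RamExpr.eval_div, RamExpr.eval_dimSq h0',
        RamExpr.eval_var, h17, hcol, ← Int.natCast_div]
    · rw [h2 10 (by decide), ← h10 r hrn.le]
      congr 1
      ring
    · simp only [List.mem_cons, List.not_mem_nil, not_or, or_false] at hy
      rw [h3 y (by simp; tauto), h2 y (by simp; tauto)]
    · ext i'
      have := congrFun (congrFun hXP i') j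
      simpa [Matrix.mul_apply, Matrix.mulVec, dotProduct] using this

/-- The sign of the last determinant decides. If negative, the column already written is kept; if
zero, it is overwritten by a kernel vector, even when an earlier round had found a column. -/
theorem wp_progConvert {M : Matrix (Fin n) (Fin n) ℚ} {α : Finset (Fin n)} {b G : ℕ}
    (hb : b = 2 ^ (2 * bitSize M)) (hbN : b < 2 ^ N)
    (hG : n * n * b + n * b ≤ G) (hG1 : 1 ≤ G) (hn : n * (n * n) ≤ N) (hnn : n * n ≤ N)
    (hN : G ^ n < 2 ^ N) (hdet : (rowMask (clearDen M) α n).det ≤ 0) :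
    progConvert.WP N (inputMemory M α) fun s' => (∀ i : Fin n, s' 5 (i : ℕ) = 1) ∧
      ∃ x : Fin n → ℤ, IsConversion (clearDen M) α x ∧ ∀ i : Fin n, s' 4 (i : ℕ) = x i := by
  have hpos : 0 < n := by
    rcases Nat.eq_zero_or_pos n with rfl | h
    · simp at hdet
    · exact h
  have hnN : n ≤ N := (Nat.le_mul_self n).trans hnn
  have hb1 : 1 ≤ b := hb ▸ Nat.one_le_two_pow
  set A := clearDen M with hA
  have hAb : ∀ i j, (A i j).natAbs ≤ b := hb ▸ natAbs_clearDen_le M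
  set s := inputMemory M α with hs
  have h0 : s 0 0 = n := by simp [hs, inputMemory]
  have h1 : ∀ i : Fin n, s 1 (i : ℕ) = if i ∈ α then 1 else 0 := by
    intro i
    have : (∃ i' ∈ α, ((i' : ℕ) : ℤ) = (i : ℕ)) ↔ i ∈ α := by
      constructor
      · rintro ⟨i', h, h'⟩
        rwa [← Fin.ext (Nat.cast_injective h')]
      · exact fun h => ⟨i, h, rfl⟩
    simp only [hs, inputMemory, this]
  refine .seq (wp_progClearDen h0 (rowMajor_apply _) (rowMajor_apply _) hnn (hb ▸ hbN)
    fun s2 h2 h2v => .seq ?_)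
  have h02 : s2 0 0 = n := by rw [h2 0 (by decide), h0]
  refine .fillMat 0 (fun i j => (1 : Matrix (Fin n) (Fin n) ℤ) i j) hnn (by decide)
    (by decide) (by decide) (fun s' h => RamExpr.eval_dimSq ?_) (fun _ _ => rfl)
    (fun i j => ?_) (fun i j s' h h14 => ?_) (fun s3 h3 h3v _ => .seq ?_)
  · rw [h 0 (by decide) (by decide) (by decide), h02]
  · rw [← rowMask_zero A α]
    exact (natAbs_rowMask_le α 0 hAb hb1 i j).trans_lt hbN
  · have h0' : s' 0 0 = n := by rw [h 0 (by decide) (by decide) (by decide), h02]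
    exact .skip (RamExpr.eval_delta (RamExpr.eval_row h0' h14) (RamExpr.eval_col h0' h14))
  · have hfr3 : ∀ x ∉ [6, 7, 9, 14], s3 x = s x := by
      intro x hx
      simp only [List.mem_cons, List.not_mem_nil, not_or, or_false] at hx
      rw [h3 x (by tauto) (by tauto) (by simp [RamProg.writes]), h2 x (by simp; tauto)]
    have h73 : ∀ i j : Fin n, s3 7 (((i : ℕ) : ℤ) * n + (j : ℕ)) = A i j := by
      rwa [h3 7 (by decide) (by decide) (by decide)]
    refine .forLoop (RoundInv A α) n hnN (by decide) (fun _ _ _ h h' => h'.congr h)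
      (fun s' h => ?_) ⟨?_, fun h => absurd h (lt_irrefl _), fun h => absurd h (lt_irrefl _),
        .inl ⟨?_, ?_⟩⟩ (fun k hk s' h h8 hI => ?_) (fun s4 h4 hI => .seq ?_)
    · rw [RamExpr.eval_var, h 0 (by decide) (by decide), hfr3 0 (by decide), h0]
    · simpa [rowMask_zero] using h3v
    · rw [hfr3 16 (by decide)]
      rfl
    · intro q hq
      obtain rfl : q = 0 := by omega
      simp [rowMask_zero]
    · refine wp_progRound (j := ⟨k, hk⟩) ?_ h8 ?_ ?_ hAb hb1 hbN hG hG1 hnn hN hI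
      · rw [h 0 (by decide) (by decide), hfr3 0 (by decide), h0]
      · rwa [h 1 (by decide) (by decide), hfr3 1 (by decide)]
      · rwa [h 7 (by decide) (by decide)]
    · have h04 : s4 0 0 = n := by rw [h4 0 (by decide) (by decide), hfr3 0 (by decide), h0]
      have hfinal : ∀ s5 : RamMemory, s5 0 0 = n → (∃ x : Fin n → ℤ, IsConversion A α x ∧
          ∀ i : Fin n, s5 4 (i : ℕ) = x i) →
          (RamProg.fill 14 5 (.var 0) (.const 0) .skip (.const 1)).WP N s5 fun s' =>
            (∀ i : Fin n, s' 5 (i : ℕ) = 1) ∧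
            ∃ x : Fin n → ℤ, IsConversion A α x ∧ ∀ i : Fin n, s' 4 (i : ℕ) = x i := by
        rintro s5 h05 ⟨x, hx, hx4⟩
        refine .fill 0 (fun _ : Fin n => 1) hnN (by decide) (by decide) (by decide)
          (fun s' h => ?_) (fun _ _ => rfl) (fun _ => by simpa using hb1.trans_lt hbN)
          (fun _ _ _ _ => .skip rfl) (fun s' h h5 _ => ⟨by simpa using h5, x, hx, ?_⟩)
        · rw [RamExpr.eval_var, h 0 (by decide) (by decide) (by decide), h05]
        · rwa [h 4 (by decide) (by decide) (by decide)]
      have heval : (RamExpr.sub (.const 0) (.var 12)).eval s4 = -(rowMask A α n).det := by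
        rw [RamExpr.eval_sub, RamExpr.eval_const, RamExpr.eval_var, hI.det hpos, zero_sub]
      refine .branch (fun he => .skip (hfinal s4 h04 ?_)) (fun he => ?_)
      · rw [heval] at he
        rcases hI.out with h | ⟨-, j, h5, h6, h7⟩
        · exact absurd (h.2 n le_rfl) (not_lt.2 hdet)
        · exact ⟨fun i => (rowMask A α (j + 1)).adjugate i j,
            isConversion_of_adjugate (by omega) j h5 h6 fun _ => rfl, h7⟩
      · rw [heval] at he
        have hdet0 : (rowMask A α n).det = 0 := by omega
        exact wp_kernelOut h04 hpos hdet0 (hI.block hpos) hn fun s5 h5 x hx0 hx h5v =>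
          hfinal s5 (by rw [h5 0 (by decide), h04]) ⟨x, isConversion_of_kernel hx0 hx, h5v⟩

theorem natAbs_rowMajor_lt {f : Fin n → Fin n → ℤ} {C : ℕ} (hC : 0 < C)
    (hf : ∀ i j, (f i j).natAbs < C) (k : ℤ) : (rowMajor f k).natAbs < C := by
  by_cases h : ∃ i j : Fin n, k = ((i : ℕ) : ℤ) * n + ((j : ℕ) : ℤ)
  · obtain ⟨i, j, rfl⟩ := h
    rw [rowMajor_apply]
    exact hf i j
  · push Not at h
    simpa [rowMajor, h] using hC

theorem bdd_inputMemory (M : Matrix (Fin n) (Fin n) ℚ) (α : Finset (Fin n)) (hn : n ≤ N)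
    (hN : bitSize M < N) : (inputMemory M α).Bdd N := by
  have hpow : 2 ^ bitSize M < 2 ^ N := Nat.pow_lt_pow_right (by norm_num) hN
  have h1 : 1 < 2 ^ N := Nat.one_le_two_pow.trans_lt hpow
  have h0 : 0 < 2 ^ N := by omega
  intro a k
  match a with
  | 0 =>
    simp only [inputMemory]
    split_ifs
    · exact hn.trans_lt Nat.lt_two_pow_self
    · exact h0
  | 1 =>
    simp only [inputMemory]
    split_ifs
    · exact h1
    · exact h0
  | 2 => exact natAbs_rowMajor_lt h0 (fun i j => (natAbs_num_lt M i j).trans hpow) k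
  | 3 =>
    exact natAbs_rowMajor_lt (f := fun i j => ((M i j).den : ℤ)) h0
      (fun i j => (den_lt M i j).trans hpow) k
  | _ + 4 => exact h0

/-- Bound for the memory width and the number of iterations in terms of the input size. -/
noncomputable def widthBound : Polynomial ℕ :=
  Polynomial.X ^ 3 + Polynomial.X ^ 2 + (4 * Polynomial.X + 1) * Polynomial.X +
    2 * Polynomial.X + 1

theorem progConvert_outputsWithin (M : Matrix (Fin n) (Fin n) ℚ) (α : Finset (Fin n))
    (hdet : (rowMask (clearDen M) α n).det ≤ 0) :
    ∃ x : Fin n → ℤ, IsConversion (clearDen M) α x ∧ OutputsWithin progConvert M α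
      ((progConvert.timePoly.comp widthBound).eval (n + bitSize M)) fun i => (x i : ℚ) := by
  set S := n + bitSize M with hS
  -- `S ^ 3` and `S ^ 2` bound the loop lengths `n * (n * n)` and `n * n`. `(4 * S + 1) * S` bounds
  -- the exponent of `G ^ n` for `G = 2 ^ (4 * S + 1)`, `2 * S` that of the entries of `clearDen M`,
  -- and `+ 1` makes the inequalities strict.
  set N := S ^ 3 + S ^ 2 + (4 * S + 1) * S + 2 * S + 1 with hN
  have heval : widthBound.eval S = N := by simp [widthBound, hN]
  have hnS : n ≤ S := Nat.le_add_right _ _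
  have hBS : bitSize M ≤ S := Nat.le_add_left _ _
  have h3 : n * (n * n) ≤ S ^ 3 :=
    (Nat.mul_le_mul hnS (Nat.mul_le_mul hnS hnS)).trans (by rw [pow_succ, pow_two, mul_assoc])
  have h2 : n * n ≤ S ^ 2 := (Nat.mul_le_mul hnS hnS).trans (by rw [pow_two])
  have hG : n * n * 2 ^ (2 * bitSize M) + n * 2 ^ (2 * bitSize M) ≤ 2 ^ (4 * S + 1) := by
    have hn2 : n ≤ 2 ^ S := hnS.trans Nat.lt_two_pow_self.le
    have hb2 : 2 ^ (2 * bitSize M) ≤ 2 ^ (2 * S) :=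
      Nat.pow_le_pow_right (by norm_num) (by omega)
    calc n * n * 2 ^ (2 * bitSize M) + n * 2 ^ (2 * bitSize M)
        ≤ n * n * 2 ^ (2 * bitSize M) + n * n * 2 ^ (2 * bitSize M) :=
          Nat.add_le_add_left (Nat.mul_le_mul_right _ (Nat.le_mul_self n)) _
      _ ≤ 2 ^ S * 2 ^ S * 2 ^ (2 * S) + 2 ^ S * 2 ^ S * 2 ^ (2 * S) := by gcongr
      _ = 2 ^ (4 * S + 1) := by ring
  have hwp := wp_progConvert (N := N) (M := M) (α := α) rfl
    (Nat.pow_lt_pow_right (by norm_num) (by omega)) hG Nat.one_le_two_pow (by omega) (by omega)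
    (by
      rw [← pow_mul]
      refine Nat.pow_lt_pow_right (by norm_num) ?_
      have := Nat.mul_le_mul_left (4 * S + 1) hnS
      omega) hdet
  obtain ⟨s, t, hr, ht, -, h5, x, hx, h4⟩ :=
    hwp (bdd_inputMemory M α (by omega) (by omega))
  refine ⟨x, hx, s, t, hr, ?_, fun i => ?_⟩
  · rwa [Polynomial.eval_comp, heval]
  · rw [h5, h4]
    simp

end ConversionProgramCorrectness

theorem mainTheorem1 :
    -- conversion algorithm on rational data, in time polynomial in `n` and the bit size of `M`
    (∃ (c : RamProg) (p : Polynomial ℕ),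
      ∀ (n : ℕ) (M : Matrix (Fin n) (Fin n) ℚ) (α : Finset (Fin n)), IsNonposMinor M α →
        ∃ y : α → ℚ,
          OutputsWithin c M α (p.eval (n + bitSize M)) (padZero α y) ∧
          IsSignReversing M (padZero α y) ∧
          ((principal M α).det = 0 → principal M α *ᵥ y = 0)) ∧
    -- the real vectors behind the conversion
    (∀ (n : ℕ) (M : Matrix (Fin n) (Fin n) ℝ) (α : Finset (Fin n)),
      ((principal M α).det = 0 → ∃ y : α → ℝ, y ≠ 0 ∧ principal M α *ᵥ y = 0) ∧
      (∀ y : α → ℝ, y ≠ 0 → principal M α *ᵥ y = 0 → IsSignReversing M (padZero α y)) ∧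
      ((principal M α).det < 0 → ∃ μ : ℝ, μ < 0 ∧
        ∃ y : α → ℝ, Module.End.HasEigenvector (Matrix.toLin' (principal M α)) μ y) ∧
      (∀ (μ : ℝ) (y : α → ℝ), μ < 0 →
        Module.End.HasEigenvector (Matrix.toLin' (principal M α)) μ y →
        IsSignReversing M (padZero α y))) := by
  refine ⟨⟨progConvert, progConvert.timePoly.comp widthBound, fun n M α hα => ?_⟩,
    fun n M α => ⟨Matrix.exists_mulVec_eq_zero_iff.2, fun y hy h => ?_,
      exists_neg_eigenvector_of_det_neg _, fun μ y hμ h => ?_⟩⟩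
  · have hL : (0 : ℚ) < commonDen M := by exact_mod_cast commonDen_pos M
    have hdet : (rowMask (clearDen M) α n).det ≤ 0 := by
      have h1 := det_rowMask (clearDen M) α M _ (clearDen_cast M)
      have h2 : ((rowMask (clearDen M) α n).det : ℚ) ≤ 0 := by
        rw [h1]
        exact mul_nonpos_of_nonneg_of_nonpos (pow_pos hL _).le hα
      exact_mod_cast h2
    obtain ⟨x, hx, hout⟩ := progConvert_outputsWithin M α hdet
    obtain ⟨hpad, hrev, hker⟩ := hx.spec hL (clearDen_cast M)
    exact ⟨fun i => (x i : ℚ), by rwa [hpad], by rwa [hpad], hker⟩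
  · exact isSignReversing_padZero hy le_rfl (by rw [h, zero_smul])
  · refine isSignReversing_padZero h.2 hμ.le ?_
    simpa using h.apply_eq_smul
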